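/- **Setting.** Let $\alpha\ge 0$ and let $1\ge\gamma_1\ge\gamma_2\ge\cdots>0$ be weights. For $h\in\mathbb Z^d$ put $r_\alpha(\gamma,h)=\prod_{j=1}^d r_\alpha(\gamma_j,h_j)$, where $r_\alpha(\gamma_j,0)=1$ and, for $h_j\ne0$, $r_\alpha(\gamma_j,h_j)=\gamma_j^{-1}|h_j|^\alpha$ if $\alpha>0$ and $r_\alpha(\gamma_j,h_j)=1$ if $\alpha=0$. The weighted Korobov space $H_d$ consists of the $1$-periodic complex functions $f\in L_2([0,1]^d)$ with $\|f\|_d=\big(\sum_{h\in\mathbb Z^d}r_\alpha(\gamma,h)|\hat f(h)|^2\big)^{1/2}<\infty$, where $\hat f(h)$ are the Fourier coefficients. Put $s_\gamma=\inf\{s>0:\sum_j\gamma_j^s<\infty\}$ (with $\inf\emptyset=\infty$). We approximate the embedding $\mathrm{APP}_d:H_d\to L_2([0,1]^d)$. Let $\Lambda$ be either $\Lambda^{\rm all}=H_d^*$ (all continuous linear functionals) or, for $\alpha>1$, $\Lambda^{\rm std}$ (all function values $f\mapsto f(x)$ of the continuous representative of $f$). A randomized algorithm using $n$ functionals from $\Lambda$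 is $A_{n,d}(f,\omega)=\phi_\omega(L_{1,\omega}(f),\dots,L_{n,\omega}(f))$ with $L_{k,\omega}\in\Lambda$, $\phi_\omega:\mathbb C^n\to L_2([0,1]^d)$ and $\omega$ distributed according to a probability measure, where $\|f-A_{n,d}(f,\omega)\|_{L_2}$ is jointly measurable in $(f,\omega)$. Its randomized error is $e^{\rm ran}(A_{n,d})=\sup_{\|f\|_d\le1}\big(\mathbb E\|f-A_{n,d}(f,\omega)\|_{L_2}^2\big)^{1/2}$, and $\mathrm{comp}^{\rm ran}(\varepsilon,H_d,\Lambda)$ is the minimal $n$ for which some such algorithm has randomized error at most $\varepsilon$ ($\infty$ if there is none). Approximation is tractable in $\Lambda$ if there are $C,p,q\ge0$ with $\mathrm{comp}^{\rm ran}(\varepsilon,H_d,\Lambda)\le C\varepsilon^{-p}d^q$ for all $\varepsilon\in(0,1)$ and $d=1,2,\dots$; it is strongly tractable if this holds with $q=0$, and the infimum of the $p\ge 0$ that are then possible is the exponent of strong tractability $p^*(\Lambda)$. **Theorem 2 (randomized setting).** 1. Let $\alpha\ge0$. Strong tractability and tractability in the class $\Lambda^{\rm all}$ are equivalent, and they hold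 iff $s_\gamma<\infty$ and $\alpha>0$. When this holds, $p^*(\Lambda^{\rm all})=2\max(s_\gamma,\alpha^{-1})$. 2. Let $\alpha>1$. Strong tractability and tractability in the class $\Lambda^{\rm std}$ are equivalent, and they hold iff $s_\gamma<\infty$. When this holds, $p^*(\Lambda^{\rm std})\in[p^*(\Lambda^{\rm all}),p^*(\Lambda^{\rm all})+2]$. 3. Let $\alpha>1$. For $\varepsilon\in(0,1)$ and $d\ge1$ let $R=R(\varepsilon/\sqrt2,d)=\{h\in\mathbb Z^d:r_\alpha(\gamma,h)^{-1}>\varepsilon^2/2\}$ (a finite set) and $n=\lceil 2|R|/\varepsilon^2\rceil$. The algorithm $$A_{n,d}(f,\omega)(x)=\sum_{h\in R}y_h\,e^{2\pi i h\cdot x},\qquad y_h=\frac1n\sum_{k=1}^n f(\omega_k)e^{-2\pi i h\cdot\omega_k},$$ with independent $\omega_1,\dots,\omega_n$ uniformly distributed on $[0,1]^d$, is a randomized algorithm using $n$ function values, and its randomized error is at most $\varepsilon$. If moreover $s_\gamma<\infty$, then for every $\delta>0$ there is $K_\delta>0$, depending only on $\delta$, $\alpha$ and $\gamma$, such that with $p=p^*(\Lambda^{\rm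 all})+\delta$, for all $d=1,2,\dots$ and all $\varepsilon\in(0,1)$, we have $n\le K_\delta\,\varepsilon^{-(p+2)}$, and the total cost of $A_{n,d}$ is at most $$K_\delta\left(\Big(\frac1\varepsilon\Big)^{p+2}\mathbf c(d)+\Big(\frac1\varepsilon\Big)^{2p+2}d\right).$$ Here the cost is that of a straight-line program (depending on $\varepsilon$ and $d$, but not on $f$, the samples or $\mathbf c(d)$) which, from the coordinates of $\omega_1,\dots,\omega_n$ and of a point $x$, computes all $y_h$, $h\in R$, and then $A_{n,d}(f,\omega)(x)$; an evaluation of $f$ at a computed point costs $\mathbf c(d)\ge0$, and every arithmetic operation on complex numbers, comparison, exponential or constant costs $1$. -/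

import Mathlib

open MeasureTheory
open scoped ENNReal

-- The circle `ℝ / ℤ` carries its Haar measure of total mass one, which is the image of the Lebesgue
-- measure on `[0,1]`; this is the normalization that Mathlib uses for multivariate Fourier series.
attribute [local instance] instMeasureSpaceUnitAddCircle

noncomputable section

namespace WeightedKorobov

/-! ### Weighted Korobov spaces -/

/-- The space of square integrable complex functions on `[0,1]^d`, realized on the torus
`(ℝ / ℤ)^d` with its uniform probability measure. -/
abbrev L2 (d : ℕ) : Type := Lp ℂ 2 (volume : Measure (UnitAddTorus (Fin d)))

/-- A weight sequence `1 ≥ γ₁ ≥ γ₂ ≥ ⋯ > 0`; the entry with index `j : ℕ` is the weight of the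
variable number `j + 1`. -/
structure Weights where
  weight : ℕ → ℝ
  pos : ∀ j, 0 < weight j
  anti : Antitone weight
  le_one : weight 0 ≤ 1

/-- The one-dimensional factor: `1` if `m = 0`, and `g ^ (-s) * |m| ^ α` otherwise, where `s = 1`
for `α > 0` and `s = 0` for `α = 0`. -/
def rFactor (α g : ℝ) (m : ℤ) : ℝ :=
  if m = 0 then 1 else (if α = 0 then 1 else g⁻¹) * |(m : ℝ)| ^ α

/-- `r_α(γ, h) = ∏ⱼ r_α(γⱼ, hⱼ)`. -/
def rWeight (α : ℝ) (γ : Weights) {d : ℕ} (h : Fin d → ℤ) : ℝ :=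
  ∏ j : Fin d, rFactor α (γ.weight j) (h j)

theorem rWeight_pos (α : ℝ) (γ : Weights) {d : ℕ} (h : Fin d → ℤ) : 0 < rWeight α γ h := by
  refine Finset.prod_pos fun j _ => ?_
  unfold rFactor
  split_ifs with h0 h1
  · exact one_pos
  · rw [one_mul]
    exact Real.rpow_pos_of_pos (abs_pos.mpr (by exact_mod_cast h0)) _
  · exact mul_pos (inv_pos.mpr (γ.pos j))
      (Real.rpow_pos_of_pos (abs_pos.mpr (by exact_mod_cast h0)) _)

/-- The Fourier coefficient `∫ exp(-2πi h·x) f(x) dx`. -/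
def coeff {d : ℕ} (f : L2 d) (h : Fin d → ℤ) : ℂ :=
  UnitAddTorus.mFourierCoeff (f : UnitAddTorus (Fin d) → ℂ) h

theorem coeff_eq_repr {d : ℕ} (f : L2 d) (h : Fin d → ℤ) :
    coeff f h = UnitAddTorus.mFourierBasis.repr f h :=
  (UnitAddTorus.mFourierBasis_repr f h).symm

theorem coeff_add {d : ℕ} (f g : L2 d) (h : Fin d → ℤ) :
    coeff (f + g) h = coeff f h + coeff g h := by
  simp [coeff_eq_repr]

theorem coeff_smul {d : ℕ} (c : ℂ) (f : L2 d) (h : Fin d → ℤ) :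
    coeff (c • f) h = c * coeff f h := by
  simp [coeff_eq_repr]

theorem coeff_zero {d : ℕ} (h : Fin d → ℤ) : coeff (0 : L2 d) h = 0 := by
  simp [coeff_eq_repr]

theorem eq_zero_of_coeff {d : ℕ} (f : L2 d) (hf : ∀ h, coeff f h = 0) : f = 0 := by
  apply (UnitAddTorus.mFourierBasis (d := Fin d)).repr.injective
  ext h
  simpa [coeff_eq_repr] using hf h

theorem summable_add (α : ℝ) (γ : Weights) {d : ℕ} {f g : L2 d}
    (hf : Summable fun h : Fin d → ℤ => rWeight α γ h * ‖coeff f h‖ ^ 2)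
    (hg : Summable fun h : Fin d → ℤ => rWeight α γ h * ‖coeff g h‖ ^ 2) :
    Summable fun h : Fin d → ℤ => rWeight α γ h * ‖coeff (f + g) h‖ ^ 2 := by
  refine Summable.of_nonneg_of_le
    (fun h => mul_nonneg (rWeight_pos α γ h).le (sq_nonneg _)) (fun h => ?_)
    ((hf.mul_left 2).add (hg.mul_left 2))
  have hr := (rWeight_pos α γ h).le
  have h1 : ‖coeff (f + g) h‖ ^ 2 ≤ 2 * ‖coeff f h‖ ^ 2 + 2 * ‖coeff g h‖ ^ 2 := by
    rw [coeff_add]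
    have := norm_add_le (coeff f h) (coeff g h)
    nlinarith [sq_nonneg (‖coeff f h‖ - ‖coeff g h‖), norm_nonneg (coeff f h + coeff g h)]
  nlinarith [mul_le_mul_of_nonneg_left h1 hr]

/-- The functions `f ∈ L₂` with `∑_h r_α(γ, h) |f̂(h)|² < ∞`. -/
def korobovSubmodule (α : ℝ) (γ : Weights) (d : ℕ) : Submodule ℂ (L2 d) where
  carrier := {f | Summable fun h : Fin d → ℤ => rWeight α γ h * ‖coeff f h‖ ^ 2}
  add_mem' hf hg := summable_add α γ hf hg
  zero_mem' := by simp [coeff_zero]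
  smul_mem' c f hf := by
    refine (Summable.mul_left (‖c‖ ^ 2) hf).congr fun h => ?_
    rw [coeff_smul, norm_mul]
    ring

/-- The weighted Korobov space `H_d`. It is a type of its own, since its norm is not the norm that
it inherits from `L₂`. -/
def Korobov (α : ℝ) (γ : Weights) (d : ℕ) : Type := ↥(korobovSubmodule α γ d)

namespace Korobov

variable {α : ℝ} {γ : Weights} {d : ℕ}

instance : AddCommGroup (Korobov α γ d) := inferInstanceAs (AddCommGroup (korobovSubmodule α γ d))

instance : Module ℂ (Korobov α γ d) := inferInstanceAs (Module ℂ (korobovSubmodule α γ d))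

/-- The embedding `APP_d : H_d → L₂([0,1]^d)`, `APP_d f = f`. -/
def toL2 : Korobov α γ d →ₗ[ℂ] L2 d := (korobovSubmodule α γ d).subtype

/-- `‖f‖_d = (∑_h r_α(γ, h) |f̂(h)|²)^(1/2)`. -/
instance : Norm (Korobov α γ d) :=
  ⟨fun f => Real.sqrt (∑' h : Fin d → ℤ, rWeight α γ h * ‖coeff (toL2 f) h‖ ^ 2)⟩

theorem norm_def (f : Korobov α γ d) :
    ‖f‖ = Real.sqrt (∑' h : Fin d → ℤ, rWeight α γ h * ‖coeff (toL2 f) h‖ ^ 2) := rfl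

theorem summable (f : Korobov α γ d) :
    Summable fun h : Fin d → ℤ => rWeight α γ h * ‖coeff (toL2 f) h‖ ^ 2 := f.2

theorem normCore : NormedSpace.Core ℂ (Korobov α γ d) where
  norm_nonneg f := Real.sqrt_nonneg _
  norm_smul c f := by
    have hc : ‖c‖ = Real.sqrt (‖c‖ ^ 2) := (Real.sqrt_sq (norm_nonneg c)).symm
    rw [norm_def, norm_def, hc, ← Real.sqrt_mul (sq_nonneg _), ← tsum_mul_left]
    congr 2
    ext h
    rw [map_smul, coeff_smul, norm_mul]
    ring
  norm_triangle f g := by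
    have key : ∀ (u : Korobov α γ d) (h : Fin d → ℤ),
        (Real.sqrt (rWeight α γ h) * ‖coeff (toL2 u) h‖) ^ (2 : ℝ)
          = rWeight α γ h * ‖coeff (toL2 u) h‖ ^ 2 := fun u h => by
      rw [Real.rpow_two, mul_pow, Real.sq_sqrt (rWeight_pos α γ h).le]
    have nn : ∀ (u : Korobov α γ d) (h : Fin d → ℤ),
        0 ≤ Real.sqrt (rWeight α γ h) * ‖coeff (toL2 u) h‖ := fun u h =>
      mul_nonneg (Real.sqrt_nonneg _) (norm_nonneg _)
    have M := Real.Lp_add_le_tsum_of_nonneg (p := 2) one_le_two (nn f) (nn g)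
      (by simpa only [key] using f.summable) (by simpa only [key] using g.summable)
    simp only [key, ← Real.sqrt_eq_rpow] at M
    refine le_trans (Real.sqrt_le_sqrt ?_) M.2
    refine Summable.tsum_le_tsum (fun h => ?_) (f + g).summable M.1
    rw [← key]
    refine Real.rpow_le_rpow (nn _ h) ?_ zero_le_two
    rw [map_add, coeff_add, ← mul_add]
    exact mul_le_mul_of_nonneg_left (norm_add_le _ _) (Real.sqrt_nonneg _)
  norm_eq_zero_iff f := by
    have nn : ∀ h : Fin d → ℤ, 0 ≤ rWeight α γ h * ‖coeff (toL2 f) h‖ ^ 2 := fun h =>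
      mul_nonneg (rWeight_pos α γ h).le (sq_nonneg _)
    rw [norm_def, Real.sqrt_eq_zero (tsum_nonneg nn)]
    constructor
    · intro h0
      have hz := (f.summable.hasSum_iff.mpr h0)
      rw [hasSum_zero_iff_of_nonneg nn] at hz
      apply Subtype.ext
      apply eq_zero_of_coeff
      intro h
      have hh : rWeight α γ h * ‖coeff (toL2 f) h‖ ^ 2 = 0 := congrFun hz h
      have h2 : coeff (toL2 f) h = 0 := by simpa [(rWeight_pos α γ h).ne'] using hh
      exact h2
    · rintro rfl
      simp [coeff_zero]

instance : NormedAddCommGroup (Korobov α γ d) := NormedAddCommGroup.ofCore normCore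

instance : NormedSpace ℂ (Korobov α γ d) := NormedSpace.ofCore normCore

instance : MeasurableSpace (Korobov α γ d) := borel _

instance : BorelSpace (Korobov α γ d) := ⟨rfl⟩

open Classical in
/-- The function value `f(x)`: the value at `x` of the continuous representative of `f`. This
representative is unique, and it exists for all `f` in the space if `α > 1`. -/
def value (f : Korobov α γ d) (x : UnitAddTorus (Fin d)) : ℂ :=
  if h : ∃ g : C(UnitAddTorus (Fin d), ℂ),
      (toL2 f : UnitAddTorus (Fin d) → ℂ) =ᵐ[volume] (g : UnitAddTorus (Fin d) → ℂ)
  then h.choose x else 0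

end Korobov

/-- The sum-exponent `s_γ = inf {s > 0 : ∑ γⱼ^s < ∞}`, with `inf ∅ = ∞`. -/
def sumExponent (γ : Weights) : ℝ≥0∞ :=
  ⨅ (s : ℝ) (_ : 0 < s) (_ : Summable fun j => γ.weight j ^ s), ENNReal.ofReal s

/-! ### Randomized algorithms and tractability -/

/-- The class `Λ^all`: all continuous linear functionals on `H_d`. -/
def LambdaAll (α : ℝ) (γ : Weights) (d : ℕ) : Set (Korobov α γ d → ℂ) :=
  {L | ∃ T : Korobov α γ d →L[ℂ] ℂ, L = T}

/-- The class `Λ^std`: all function values `f ↦ f(x)`. -/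
def LambdaStd (α : ℝ) (γ : Weights) (d : ℕ) : Set (Korobov α γ d → ℂ) :=
  {L | ∃ x : UnitAddTorus (Fin d), L = fun f => f.value x}

section Algorithms

variable {α : ℝ} {γ : Weights} {d : ℕ}

/-- `A(f, ω) = φ_ω(L_{1,ω}(f), …, L_{n,ω}(f))` with `L_{k,ω} ∈ Λ`, where `ω` is distributed
according to the probability measure `ρ`, and the error is a measurable function of `(f, ω)`. -/
def IsRandomizedAlgorithm (Λ : Set (Korobov α γ d → ℂ)) (n : ℕ) {Ω : Type} [MeasurableSpace Ω]
    (ρ : Measure Ω) (A : Korobov α γ d → Ω → L2 d) : Prop :=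
  IsProbabilityMeasure ρ ∧
  (∃ (L : Fin n → Ω → Korobov α γ d → ℂ) (φ : Ω → (Fin n → ℂ) → L2 d),
    (∀ k ω, L k ω ∈ Λ) ∧ ∀ f ω, A f ω = φ ω fun k => L k ω f) ∧
  Measurable fun q : Korobov α γ d × Ω => ‖q.1.toL2 - A q.1 q.2‖

/-- The randomized error: the supremum over the unit ball of `H_d` of the square root of the
expectation of `‖f - A(f, ω)‖²` in `L₂`. -/
def ranError {Ω : Type} [MeasurableSpace Ω] (ρ : Measure Ω) (A : Korobov α γ d → Ω → L2 d) :
    ℝ≥0∞ :=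
  ⨆ (f : Korobov α γ d) (_ : ‖f‖ ≤ 1), (∫⁻ ω, ‖f.toL2 - A f ω‖ₑ ^ 2 ∂ρ) ^ (1 / 2 : ℝ)

/-- The minimal `n` for which some randomized algorithm that uses `n` functionals from `Λ` has
randomized error at most `ε` (`⊤` if there is none). -/
def compRan (ε : ℝ) (Λ : Set (Korobov α γ d → ℂ)) : ℕ∞ :=
  ⨅ (n : ℕ) (_ : ∃ (Ω : Type) (_ : MeasurableSpace Ω) (ρ : Measure Ω)
      (A : Korobov α γ d → Ω → L2 d),
    IsRandomizedAlgorithm Λ n ρ A ∧ ranError ρ A ≤ ENNReal.ofReal ε), (n : ℕ∞)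

end Algorithms

section Tractability

variable {α : ℝ} {γ : Weights} (Λ : (d : ℕ) → Set (Korobov α γ d → ℂ))

/-- `comp(ε, H_d, Λ) ≤ C ε^(-p) d^q` for all `ε ∈ (0,1)` and `d = 1, 2, …`. -/
def CompBound (C p q : ℝ) : Prop :=
  ∀ ε : ℝ, 0 < ε → ε < 1 → ∀ d : ℕ, 1 ≤ d →
    (compRan ε (Λ d) : ℝ≥0∞) ≤ ENNReal.ofReal (C * ε ^ (-p) * (d : ℝ) ^ q)

def Tractable : Prop :=
  ∃ C p q : ℝ, 0 ≤ C ∧ 0 ≤ p ∧ 0 ≤ q ∧ CompBound Λ C p q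

def StronglyTractable : Prop :=
  ∃ C p : ℝ, 0 ≤ C ∧ 0 ≤ p ∧ CompBound Λ C p 0

/-- The exponent of strong tractability (meaningful if the problem is strongly tractable). -/
def strongExponent : ℝ :=
  sInf {p : ℝ | 0 ≤ p ∧ ∃ C : ℝ, 0 ≤ C ∧ CompBound Λ C p 0}

end Tractability

/-! ### The Monte Carlo algorithm -/

/-- `R(ε, d) = {h : r_α(γ, h)⁻¹ > ε²}`. -/
def indexSet (α : ℝ) (γ : Weights) (ε : ℝ) (d : ℕ) : Set (Fin d → ℤ) :=
  {h | (rWeight α γ h)⁻¹ > ε ^ 2}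

/-- The number of samples, `2 |R(ε/√2, d)| / ε²` rounded up to an integer. -/
def mcSamples (α : ℝ) (γ : Weights) (ε : ℝ) (d : ℕ) : ℕ :=
  ⌈2 * ((indexSet α γ (ε / Real.sqrt 2) d).ncard : ℝ) / ε ^ 2⌉₊

section MonteCarlo

variable {α : ℝ} {γ : Weights} {d : ℕ}

/-- `y_h = (1/n) ∑ₖ f(ωₖ) exp(-2πi h·ωₖ)`. -/
def mcCoeff {n : ℕ} (f : Korobov α γ d) (ω : Fin n → UnitAddTorus (Fin d)) (h : Fin d → ℤ) : ℂ :=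
  (1 / (n : ℂ)) * ∑ k : Fin n, f.value (ω k) * UnitAddTorus.mFourier (-h) (ω k)

/-- The Monte Carlo algorithm: `∑_h y_h exp(2πi h·x)` with `h` ranging over `R(ε/√2, d)`, as an
element of `L₂`. -/
def mcAlgorithm (ε : ℝ) (f : Korobov α γ d)
    (ω : Fin (mcSamples α γ ε d) → UnitAddTorus (Fin d)) : L2 d :=
  ∑ᶠ h ∈ indexSet α γ (ε / Real.sqrt 2) d, mcCoeff f ω h • UnitAddTorus.mFourierLp 2 h

end MonteCarlo

/-! ### Cost: straight-line programs over the complex numbers with function evaluations -/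

/-- An operand is an input or the result of an earlier instruction. -/
inductive Operand (ι : Type) where
  | input (i : ι)
  | reg (k : ℕ)

/-- The instructions: constants, arithmetic, the exponential function, a selection by comparison of
real parts, and the evaluation of `f` at a point whose coordinates have been computed. -/
inductive Instr (ι : Type) (d : ℕ) where
  | const (z : ℂ)
  | add (a b : Operand ι)
  | sub (a b : Operand ι)
  | mul (a b : Operand ι)
  | div (a b : Operand ι)
  | exp (a : Operand ι)
  | select (a b u v : Operand ι)
  | query (p : Fin d → Operand ι)

section Programs

variable {ι : Type} {d : ℕ}

def Operand.get (x : ι → ℂ) (regs : List ℂ) : Operand ι → ℂ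
  | .input i => x i
  | .reg k => regs.getD k 0

open Classical in
/-- The result of an instruction, given the function `F`, the input and the earlier results. -/
def Instr.eval (F : (Fin d → ℝ) → ℂ) (x : ι → ℂ) (regs : List ℂ) : Instr ι d → ℂ
  | .const z => z
  | .add a b => a.get x regs + b.get x regs
  | .sub a b => a.get x regs - b.get x regs
  | .mul a b => a.get x regs * b.get x regs
  | .div a b => a.get x regs / b.get x regs
  | .exp a => Complex.exp (a.get x regs)
  | .select a b u v =>
      if (a.get x regs).re ≤ (b.get x regs).re then u.get x regs else v.get x regs
  | .query p => F fun j => ((p j).get x regs).re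

/-- A function evaluation costs `c`, every other instruction costs `1`. -/
def Instr.cost (c : ℝ) : Instr ι d → ℝ
  | .query _ => c
  | _ => 1

/-- The list of the results of all instructions, in the order of execution. -/
def runProgram (F : (Fin d → ℝ) → ℂ) (x : ι → ℂ) (P : List (Instr ι d)) : List ℂ :=
  P.foldl (fun regs I => regs ++ [I.eval F x regs]) []

def programCost (c : ℝ) (P : List (Instr ι d)) : ℝ :=
  (P.map (Instr.cost c)).sum

end Programs

/-- The point of the torus with the coordinates `x`. -/
def toTorus {d : ℕ} (x : Fin d → ℝ) : UnitAddTorus (Fin d) := fun j => (x j : UnitAddCircle)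

/-- The program `P` implements the Monte Carlo algorithm: for all `f`, all sample points
`ω₁, …, ωₙ` and every point `x`, from the coordinates of these points it computes, in the registers
that `out` prescribes, the coefficients `y_h` for all `h ∈ R(ε/√2, d)`, and then, in the register
`res`, the value at `x` of the approximation of `f`. -/
def ImplementsMC (α : ℝ) (γ : Weights) (ε : ℝ) (d : ℕ)
    (P : List (Instr ((Fin (mcSamples α γ ε d) × Fin d) ⊕ Fin d) d)) : Prop :=
  ∃ (out : (Fin d → ℤ) → ℕ) (res : ℕ),
    ∀ (f : Korobov α γ d) (ω : Fin (mcSamples α γ ε d) → Fin d → ℝ) (x : Fin d → ℝ),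
      let regs := runProgram (fun t => f.value (toTorus t))
        (Sum.elim (fun q => ((ω q.1 q.2 : ℝ) : ℂ)) fun j => ((x j : ℝ) : ℂ)) P
      (∀ h ∈ indexSet α γ (ε / Real.sqrt 2) d,
        regs.getD (out h) 0 = mcCoeff f (fun k => toTorus (ω k)) h) ∧
      regs.getD res 0 = ∑ᶠ h ∈ indexSet α γ (ε / Real.sqrt 2) d,
        mcCoeff f (fun k => toTorus (ω k)) h * UnitAddTorus.mFourier h (toTorus x)

end WeightedKorobov

end

open WeightedKorobov

noncomputable section

namespace WeightedKorobov

/-! ### Fourier coefficients and truncation -/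

/-! By Parseval, `H_d` is a weighted `ℓ₂` space of Fourier coefficients, and everything reduces to
counting the frequencies `h` with `r_α(γ, h)⁻¹` above a threshold.

For arbitrary functionals, keeping the Fourier coefficients in `R(ε, d)` is a deterministic
algorithm with error at most `ε` (`compRan_all_le`). Randomization gains only constants: if `n`
functionals reach error `ε`, then `|R(√2 ε, d)| ≤ 4n` (`card_le_of_ranError_le`). This is
Bakhvalov's argument: the supremum over inputs is bounded below by an average over a sphere of
trigonometric polynomials, and for each fixed `ω` the `n` functionals leave a kernel of real
codimension at most `2n` on which nothing is known.

The counting goes both ways. For `s > 1/α` the sum of `r_α(γ, h)^(-s)` is at most `∏ (1 + γⱼ^s ζ)`,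
which is bounded in `d` when `∑ γⱼ^s < ∞`; hence `|R(ε, d)| ≤ C ε^(-2s)`
(`exists_ncard_indexSet_le`). Conversely, a complexity bound is tested on two families: frequencies
in dimension one force `α > 0` and `p ≥ 2/α`, and `0/1`-vectors with `k` ones force polynomial decay
of the weights, with `s_γ ≤ p/2` in the strongly tractable case.

For `α > 1` Fourier series converge absolutely, so function values are continuous functionals and
the lower bounds carry over. In the Monte Carlo algorithm each of the `|R|` estimated coefficients
has mean square error at most `1/n` on the unit ball, and the discarded frequencies contribute at
most `ε²/2`; the choice `n ≈ 2|R|/ε²` costs the extra `2` in the exponent (`ranError_mc_le`). A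
program evaluates `f` once per sample and spends `O(|R| n d)` further instructions
(`exists_implementsMC`). -/

theorem hasSum_finset_of_eq {ι : Type*} {S : Finset ι} {f g : ι → ℝ} (hf : ∀ h ∈ S, f h = g h)
    (h0 : ∀ h ∉ S, f h = 0) : HasSum f (∑ h ∈ S, g h) := by
  rw [← Finset.sum_congr rfl hf]
  exact hasSum_sum_of_ne_finset_zero h0

theorem hasSum_sq_coeff {d : ℕ} (f : L2 d) : HasSum (fun h => ‖coeff f h‖ ^ 2) (‖f‖ ^ 2) := by
  have h := lp.hasSum_norm (p := 2) (by simp) (UnitAddTorus.mFourierBasis.repr f)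
  simpa [← coeff_eq_repr] using h

theorem coeff_mFourierLp {d : ℕ} (h k : Fin d → ℤ) :
    coeff (UnitAddTorus.mFourierLp 2 h) k = if k = h then 1 else 0 := by
  classical
  have := UnitAddTorus.mFourierBasis.repr_self (𝕜 := ℂ) h
  rw [UnitAddTorus.coe_mFourierBasis] at this
  rw [coeff_eq_repr, this]
  simp [lp.single_apply, Pi.single_apply]

theorem coeff_sub {d : ℕ} (f g : L2 d) (h : Fin d → ℤ) :
    coeff (f - g) h = coeff f h - coeff g h := by
  simp [coeff_eq_repr]

theorem coeff_sum {d : ℕ} {ι : Type*} (S : Finset ι) (g : ι → L2 d) (h : Fin d → ℤ) :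
    coeff (∑ i ∈ S, g i) h = ∑ i ∈ S, coeff (g i) h := by
  classical
  induction S using Finset.induction_on with
  | empty => simp [coeff_zero]
  | insert a s ha ih => rw [Finset.sum_insert ha, Finset.sum_insert ha, coeff_add, ih]

theorem coeff_sum_mFourierLp {d : ℕ} (S : Finset (Fin d → ℤ)) (y : (Fin d → ℤ) → ℂ)
    (k : Fin d → ℤ) :
    coeff (∑ h ∈ S, y h • UnitAddTorus.mFourierLp 2 h) k = if k ∈ S then y k else 0 := by
  simp [coeff_sum, coeff_smul, coeff_mFourierLp]

theorem one_le_rFactor {α g : ℝ} (hα : 0 ≤ α) (hg : 0 < g) (hg1 : g ≤ 1) (m : ℤ) :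
    1 ≤ rFactor α g m := by
  unfold rFactor
  split_ifs with h0 h1
  · exact le_rfl
  · simp [h1]
  · have : (1 : ℝ) ≤ |(m : ℝ)| := by exact_mod_cast Int.one_le_abs h0
    exact one_le_mul_of_one_le_of_one_le ((one_le_inv₀ hg).mpr hg1) (Real.one_le_rpow this hα)

theorem Weights.weight_le_one (γ : Weights) (j : ℕ) : γ.weight j ≤ 1 :=
  (γ.anti (Nat.zero_le j)).trans γ.le_one

theorem one_le_rWeight {α : ℝ} (hα : 0 ≤ α) (γ : Weights) {d : ℕ} (h : Fin d → ℤ) :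
    1 ≤ rWeight α γ h := by
  refine le_trans (le_of_eq (by simp)) (Finset.prod_le_prod (s := Finset.univ)
    (f := fun _ : Fin d => (1 : ℝ)) (fun _ _ => zero_le_one) fun j _ =>
    one_le_rFactor hα (γ.pos j) (γ.weight_le_one j) (h j))

theorem rWeight_zero (α : ℝ) (γ : Weights) {d : ℕ} : rWeight α γ (0 : Fin d → ℤ) = 1 := by
  simp [rWeight, rFactor]

namespace Korobov

variable {α : ℝ} {γ : Weights} {d : ℕ}

theorem hasSum_norm_sq (f : Korobov α γ d) :
    HasSum (fun h => rWeight α γ h * ‖coeff (toL2 f) h‖ ^ 2) (‖f‖ ^ 2) := by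
  rw [norm_def, Real.sq_sqrt (tsum_nonneg fun h => mul_nonneg (rWeight_pos α γ h).le (sq_nonneg _))]
  exact f.summable.hasSum

theorem norm_toL2_le (hα : 0 ≤ α) (f : Korobov α γ d) : ‖toL2 f‖ ≤ ‖f‖ := by
  refine le_of_sq_le_sq ?_ (norm_nonneg _)
  exact hasSum_le (fun h => le_mul_of_one_le_left (sq_nonneg _) (one_le_rWeight hα γ h))
    (hasSum_sq_coeff _) f.hasSum_norm_sq

theorem continuous_toL2 (hα : 0 ≤ α) : Continuous (toL2 : Korobov α γ d →ₗ[ℂ] L2 d) :=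
  AddMonoidHomClass.continuous_of_bound _ 1 fun f => by simpa using norm_toL2_le hα f

theorem norm_coeff_le (hα : 0 ≤ α) (f : Korobov α γ d) (h : Fin d → ℤ) :
    ‖coeff (toL2 f) h‖ ≤ ‖f‖ := by
  refine le_of_sq_le_sq ?_ (norm_nonneg _)
  refine le_trans ?_ (le_hasSum f.hasSum_norm_sq h fun k _ =>
    mul_nonneg (rWeight_pos α γ k).le (sq_nonneg _))
  exact le_mul_of_one_le_left (sq_nonneg _) (one_le_rWeight hα γ h)

/-- The Fourier coefficient `f ↦ f̂(h)` as a continuous linear functional. -/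
def coeffCLM (hα : 0 ≤ α) (h : Fin d → ℤ) : Korobov α γ d →L[ℂ] ℂ :=
  LinearMap.mkContinuous
    { toFun := fun f => coeff (toL2 f) h
      map_add' := fun f g => by rw [map_add, coeff_add]
      map_smul' := fun c f => by rw [map_smul, coeff_smul]; rfl } 1
    fun f => by simpa using norm_coeff_le hα f h

theorem coeffCLM_apply (hα : 0 ≤ α) (h : Fin d → ℤ) (f : Korobov α γ d) :
    coeffCLM hα h f = coeff (toL2 f) h := rfl

/-- This one estimate serves both the deterministic and the Monte Carlo algorithm. By Parseval the
frequencies in `S` contribute the errors of the coefficients, and outside `S` each `|f̂(h)|²` is at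
most `τ` times its share of `‖f‖²`. -/
theorem norm_sub_sum_sq_le (f : Korobov α γ d) (S : Finset (Fin d → ℤ)) (y : (Fin d → ℤ) → ℂ)
    {τ : ℝ} (hτ0 : 0 ≤ τ) (hτ : ∀ h ∉ S, (rWeight α γ h)⁻¹ ≤ τ) :
    ‖toL2 f - ∑ h ∈ S, y h • UnitAddTorus.mFourierLp 2 h‖ ^ 2
      ≤ ∑ h ∈ S, ‖coeff (toL2 f) h - y h‖ ^ 2 + τ * ‖f‖ ^ 2 := by
  have h1 : HasSum (fun k => if k ∈ S then ‖coeff (toL2 f) k - y k‖ ^ 2 else 0)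
      (∑ h ∈ S, ‖coeff (toL2 f) h - y h‖ ^ 2) := by
    exact hasSum_finset_of_eq (fun h hh => if_pos hh) fun h hh => if_neg hh
  refine hasSum_le (fun k => ?_) (hasSum_sq_coeff _) (h1.add (f.hasSum_norm_sq.mul_left τ))
  rw [coeff_sub, coeff_sum_mFourierLp]
  have hr := rWeight_pos α γ k
  split_ifs with hk
  · have : 0 ≤ τ * (rWeight α γ k * ‖coeff (toL2 f) k‖ ^ 2) := by positivity
    linarith
  · rw [sub_zero, zero_add, ← mul_assoc]
    refine le_mul_of_one_le_left (sq_nonneg _) ?_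
    have := mul_le_mul_of_nonneg_right (hτ k hk) hr.le
    rwa [inv_mul_cancel₀ hr.ne'] at this

/-- The trigonometric monomial `exp(2πi h·x)` as an element of the Korobov space. -/
def monomial (α : ℝ) (γ : Weights) (h : Fin d → ℤ) : Korobov α γ d :=
  ⟨UnitAddTorus.mFourierLp 2 h, by
    refine summable_of_ne_finset_zero (s := {h}) fun k hk => ?_
    rw [coeff_mFourierLp, if_neg (by simpa using hk)]
    simp⟩

theorem toL2_monomial (h : Fin d → ℤ) :
    toL2 (monomial α γ h) = UnitAddTorus.mFourierLp 2 h := rfl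

theorem norm_sum_monomial_sq (S : Finset (Fin d → ℤ)) (y : (Fin d → ℤ) → ℂ) :
    ‖∑ h ∈ S, y h • monomial α γ h‖ ^ 2 = ∑ h ∈ S, rWeight α γ h * ‖y h‖ ^ 2 := by
  refine (hasSum_norm_sq _).unique ?_
  refine hasSum_finset_of_eq (fun h hh => ?_) fun h hb => ?_
  · simp only [map_sum, map_smul, toL2_monomial, coeff_sum_mFourierLp, if_pos hh]
  · simp only [map_sum, map_smul, toL2_monomial, coeff_sum_mFourierLp, if_neg hb]
    simp

theorem norm_toL2_sum_monomial_sq (S : Finset (Fin d → ℤ)) (y : (Fin d → ℤ) → ℂ) :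
    ‖toL2 (∑ h ∈ S, y h • monomial α γ h)‖ ^ 2 = ∑ h ∈ S, ‖y h‖ ^ 2 := by
  refine (hasSum_sq_coeff _).unique ?_
  refine hasSum_finset_of_eq (fun h hh => ?_) fun h hb => ?_
  · simp only [map_sum, map_smul, toL2_monomial, coeff_sum_mFourierLp, if_pos hh]
  · simp only [map_sum, map_smul, toL2_monomial, coeff_sum_mFourierLp, if_neg hb]
    simp

end Korobov

/-! ### A lower bound for randomized algorithms -/

section Sphere

variable {E : Type*} [NormedAddCommGroup E] [InnerProductSpace ℝ E]
  [MeasurableSpace E] [BorelSpace E]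

/-- The reflection in the hyperplane orthogonal to `u - v` maps `u` to `v` and preserves `μ`. -/
theorem lintegral_inner_sq_eq {μ : Measure E}
    (hμ : ∀ e : E ≃ₗᵢ[ℝ] E, MeasurePreserving e μ μ) {u v : E}
    (huv : ‖u‖ = ‖v‖) :
    ∫⁻ x, ENNReal.ofReal (inner ℝ u x ^ 2) ∂μ = ∫⁻ x, ENNReal.ofReal (inner ℝ v x ^ 2) ∂μ := by
  set e : E ≃ₗᵢ[ℝ] E := (ℝ ∙ (u - v))ᗮ.reflection
  have he : e u = v := Submodule.reflection_sub huv
  rw [← (hμ e).lintegral_comp_emb e.toHomeomorph.measurableEmbedding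
    (fun x => ENNReal.ofReal (inner ℝ v x ^ 2))]
  simp_rw [← he, e.inner_map_map]

variable [FiniteDimensional ℝ E]

/-- Radial projection of Lebesgue measure on the punctured unit ball commutes with linear
isometries. The measure is left unnormalized, since its total mass cancels later. -/
theorem exists_invariant_measure_sphere [Nontrivial E] :
    ∃ μ : Measure E, IsFiniteMeasure μ ∧ μ Set.univ ≠ 0 ∧ (∀ᵐ x ∂μ, ‖x‖ = 1) ∧
      ∀ e : E ≃ₗᵢ[ℝ] E, MeasurePreserving e μ μ := by
  set ν : Measure E := (volume : Measure E).restrict (Metric.ball 0 1 \ {0}) with hν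
  have hs : MeasurableSet (Metric.ball (0 : E) 1 \ {0}) :=
    measurableSet_ball.diff (measurableSet_singleton 0)
  have hν_univ : ν Set.univ = volume (Metric.ball (0 : E) 1) := by
    rw [hν, Measure.restrict_apply_univ, measure_sdiff_null (measure_singleton 0)]
  have hN : Measurable fun x : E => ‖x‖⁻¹ • x := by fun_prop
  refine ⟨ν.map fun x => ‖x‖⁻¹ • x, ⟨?_⟩, ?_, ?_, fun e => ⟨e.continuous.measurable, ?_⟩⟩
  · rw [Measure.map_apply hN MeasurableSet.univ, Set.preimage_univ, hν_univ]
    exact measure_ball_lt_top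
  · rw [Measure.map_apply hN MeasurableSet.univ, Set.preimage_univ, hν_univ]
    exact (Metric.measure_ball_pos volume 0 one_pos).ne'
  · rw [ae_map_iff hN.aemeasurable (measurableSet_eq_fun measurable_norm measurable_const)]
    refine (ae_restrict_iff' hs).mpr (Filter.Eventually.of_forall fun x hx => ?_)
    have hx0 : ‖x‖ ≠ 0 := by simpa using hx.2
    rw [norm_smul, norm_inv, norm_norm, inv_mul_cancel₀ hx0]
  · have he : ν.map e = ν := by
      have h1 := (e.measurePreserving.restrict_preimage hs).map_eq
      have h2 : e ⁻¹' (Metric.ball (0 : E) 1 \ {0}) = Metric.ball (0 : E) 1 \ {0} := by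
        ext x
        simp
      rwa [h2] at h1
    rw [Measure.map_map e.continuous.measurable hN]
    have : (e ∘ fun x : E => ‖x‖⁻¹ • x) = (fun x => ‖x‖⁻¹ • x) ∘ e := by
      ext x
      simp
    rw [this, ← Measure.map_map hN e.continuous.measurable, he]

variable {μ : Measure E}

theorem lintegral_orthonormal (hμ : ∀ e : E ≃ₗᵢ[ℝ] E, MeasurePreserving e μ μ) {ι : Type*}
    [Fintype ι] {b : ι → E} (hb : ∀ i, ‖b i‖ = 1) {u : E} (hu : ‖u‖ = 1) :
    ∫⁻ x, ENNReal.ofReal (∑ i, inner ℝ (b i) x ^ 2) ∂μ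
      = Fintype.card ι * ∫⁻ x, ENNReal.ofReal (inner ℝ u x ^ 2) ∂μ := by
  simp_rw [ENNReal.ofReal_sum_of_nonneg fun i _ => sq_nonneg _]
  rw [lintegral_finsetSum _ fun i _ => by fun_prop]
  rw [Finset.sum_congr rfl fun i _ => lintegral_inner_sq_eq hμ ((hb i).trans hu.symm)]
  simp

/-- All unit vectors `u` have the same mean of `⟨u, x⟩²`. Summing over an orthonormal basis of `E`
yields the total mass, over one of `K` the mean of the squared projection. -/
theorem lintegral_norm_starProjection_sq [Nontrivial E]
    (hμ : ∀ e : E ≃ₗᵢ[ℝ] E, MeasurePreserving e μ μ) (hμ1 : ∀ᵐ x ∂μ, ‖x‖ = 1)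
    (K : Submodule ℝ E) :
    Module.finrank ℝ E * ∫⁻ x, ENNReal.ofReal (‖K.starProjection x‖ ^ 2) ∂μ
      = Module.finrank ℝ K * μ Set.univ := by
  obtain ⟨u, hu⟩ := exists_norm_eq E zero_le_one
  have h1 := lintegral_orthonormal hμ (stdOrthonormalBasis ℝ E).norm_eq_one hu
  have h2 := lintegral_orthonormal hμ (b := fun i => ((stdOrthonormalBasis ℝ K i : K) : E))
    (fun i => (stdOrthonormalBasis ℝ K).norm_eq_one i) hu
  have h3 : ∫⁻ x, ENNReal.ofReal (∑ i, inner ℝ (stdOrthonormalBasis ℝ E i) x ^ 2) ∂μ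
      = μ Set.univ := by
    rw [← lintegral_one]
    refine lintegral_congr_ae (hμ1.mono fun x hx => ?_)
    have := (stdOrthonormalBasis ℝ E).sum_sq_norm_inner_right x
    simp only [Real.norm_eq_abs, sq_abs] at this
    simp [this, hx]
  have h4 : ∀ x, ∑ i, inner ℝ ((stdOrthonormalBasis ℝ K i : K) : E) x ^ 2
      = ‖K.starProjection x‖ ^ 2 := fun x => by
    have := (stdOrthonormalBasis ℝ K).sum_sq_norm_inner_right (K.orthogonalProjectionOnto x)
    simp only [Real.norm_eq_abs, sq_abs] at this
    rw [Submodule.starProjection_apply, ← Submodule.coe_norm, ← this]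
    simp
  rw [h3, Fintype.card_fin] at h1
  simp_rw [h4, Fintype.card_fin] at h2
  rw [h1, h2]
  ring

/-- A function that is constant on the cosets of `K` has a large mean square distance from a
multiple of an isometry. -/
theorem finrank_mul_le_lintegral [Nontrivial E] {F : Type*} [NormedAddCommGroup F]
    [NormedSpace ℝ F] (hμ : ∀ e : E ≃ₗᵢ[ℝ] E, MeasurePreserving e μ μ)
    (hμ1 : ∀ᵐ x ∂μ, ‖x‖ = 1) (K : Submodule ℝ E) (T : E →ₗ[ℝ] F) {κ : ℝ}
    (hT : ∀ x, ‖T x‖ ^ 2 = κ * ‖x‖ ^ 2) (g : E → F) (hg : ∀ x y, x - y ∈ K → g x = g y)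
    (hm : Measurable fun x => ‖T x - g x‖) :
    ENNReal.ofReal κ * (Module.finrank ℝ K * μ Set.univ)
      ≤ Module.finrank ℝ E * ∫⁻ x, ENNReal.ofReal (‖T x - g x‖ ^ 2) ∂μ := by
  set e : E ≃ₗᵢ[ℝ] E := K.reflection
  have he : ∀ x, x + e x = (2 : ℝ) • K.starProjection x := fun x => by
    rw [two_smul, ← two_nsmul, Submodule.reflection_apply]; abel
  -- The negated reflection is `-1` on `K` and fixes the orthogonal complement. Thus `x` and `e' x`
  -- differ by an element of `K`, `g` cannot separate them, and one of the two errors must be large.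
  set e' : E ≃ₗᵢ[ℝ] E := e.trans (LinearIsometryEquiv.neg ℝ)
  have he' : ∀ x, x - e' x = (2 : ℝ) • K.starProjection x := fun x => by
    rw [← he]; simp [e']
  have hK : ∀ x, g (e' x) = g x := fun x => by
    refine (hg _ _ ?_).symm
    rw [he']
    exact K.smul_mem _ (K.starProjection_apply_mem x)
  have hpt : ∀ x, κ * (2 * ‖K.starProjection x‖ ^ 2)
      ≤ ‖T x - g x‖ ^ 2 + ‖T (e' x) - g (e' x)‖ ^ 2 := fun x => by
    have h1 := hT (x - e' x)
    rw [he', norm_smul, ← he', map_sub] at h1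
    have h2 : ‖T x - T (e' x)‖ ≤ ‖T x - g x‖ + ‖T (e' x) - g x‖ := by
      rw [norm_sub_rev (T (e' x))]
      exact norm_sub_le_norm_sub_add_norm_sub _ _ _
    rw [hK]
    have h3 : ‖T x - T (e' x)‖ ^ 2 ≤ (‖T x - g x‖ + ‖T (e' x) - g x‖) ^ 2 :=
      pow_le_pow_left₀ (norm_nonneg _) h2 2
    rw [h1] at h3
    norm_num at h3
    nlinarith [sq_nonneg (‖T x - g x‖ - ‖T (e' x) - g x‖)]
  -- By invariance under `e'` the two errors in `hpt` have the same integral.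
  have hint : ENNReal.ofReal κ * (2 * ∫⁻ x, ENNReal.ofReal (‖K.starProjection x‖ ^ 2) ∂μ)
      ≤ 2 * ∫⁻ x, ENNReal.ofReal (‖T x - g x‖ ^ 2) ∂μ := by
    have hswap := (hμ e').lintegral_comp_emb e'.toHomeomorph.measurableEmbedding
      (fun x => ENNReal.ofReal (‖T x - g x‖ ^ 2))
    rw [← lintegral_const_mul _ (by fun_prop), ← lintegral_const_mul _ (by fun_prop), two_mul]
    nth_rw 2 [← hswap]
    rw [← lintegral_add_left (by fun_prop)]
    refine lintegral_mono fun x => ?_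
    rw [← ENNReal.ofReal_add (sq_nonneg _) (sq_nonneg _)]
    refine le_trans (le_of_eq ?_) (ENNReal.ofReal_le_ofReal (hpt x))
    rw [← ENNReal.ofReal_ofNat, ← ENNReal.ofReal_mul (by norm_num), ← ENNReal.ofReal_mul']
    positivity
  rw [← lintegral_norm_starProjection_sq hμ hμ1 K]
  rw [mul_left_comm _ (2 : ℝ≥0∞)] at hint
  have := (ENNReal.mul_le_mul_iff_right (by norm_num) (by norm_num)).mp hint
  rw [mul_left_comm]
  gcongr

end Sphere

/-! ### Averaging over trigonometric polynomials: randomized error and the number of frequencies. -/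

section LowerBound

theorem measurable_uncurry_ofReal_sq {X Y : Type*} [MeasurableSpace X] [MeasurableSpace Y]
    {F : X → Y → ℝ} (hF : Measurable fun q : X × Y => F q.1 q.2) :
    Measurable (Function.uncurry fun y x => ENNReal.ofReal (F x y ^ 2)) :=
  ENNReal.measurable_ofReal.comp ((hF.pow_const 2).comp measurable_swap)

variable {α : ℝ} {γ : Weights} {d : ℕ}

open Korobov

/-- Trigonometric polynomials with frequencies in `S` and real coefficients, scaled by `a`. -/
def trigPoly (α : ℝ) (γ : Weights) (S : Finset (Fin d → ℤ)) (a : ℝ) :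
    EuclideanSpace ℝ S →ₗ[ℝ] Korobov α γ d where
  toFun x := ∑ h : S, ((a * x h : ℝ) : ℂ) • monomial α γ (h : Fin d → ℤ)
  map_add' x y := by
    simp only [PiLp.add_apply, mul_add, Complex.ofReal_add, add_smul, Finset.sum_add_distrib]
  map_smul' c x := by
    simp only [PiLp.smul_apply, smul_eq_mul, RingHom.id_apply, Finset.smul_sum]
    refine Finset.sum_congr rfl fun h _ => ?_
    rw [mul_left_comm, Complex.ofReal_mul, mul_smul, Complex.coe_smul]

theorem trigPoly_eq (S : Finset (Fin d → ℤ)) (a : ℝ) (x : EuclideanSpace ℝ S) :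
    ∃ y : (Fin d → ℤ) → ℂ, (∀ h : S, y h = ((a * x h : ℝ) : ℂ)) ∧
      trigPoly α γ S a x = ∑ h ∈ S, y h • monomial α γ h := by
  classical
  have hy : ∀ h : S, (fun k : Fin d → ℤ => if hk : k ∈ S then ((a * x ⟨k, hk⟩ : ℝ) : ℂ) else 0) h
      = ((a * x h : ℝ) : ℂ) := fun h => by simp
  refine ⟨fun k => if hk : k ∈ S then ((a * x ⟨k, hk⟩ : ℝ) : ℂ) else 0, hy, ?_⟩
  rw [← Finset.sum_coe_sort S]
  exact Finset.sum_congr rfl fun h _ => by simp only [hy]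

theorem norm_toL2_trigPoly_sq (S : Finset (Fin d → ℤ)) (a : ℝ) (x : EuclideanSpace ℝ S) :
    ‖toL2 (trigPoly α γ S a x)‖ ^ 2 = a ^ 2 * ‖x‖ ^ 2 := by
  obtain ⟨y, hy, h⟩ := trigPoly_eq (α := α) (γ := γ) S a x
  rw [h, norm_toL2_sum_monomial_sq, EuclideanSpace.norm_sq_eq, Finset.mul_sum,
    ← Finset.sum_coe_sort S]
  refine Finset.sum_congr rfl fun h _ => ?_
  rw [hy, Complex.norm_real, norm_mul, mul_pow, Real.norm_eq_abs a, sq_abs]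

theorem norm_trigPoly_le {S : Finset (Fin d → ℤ)} {a : ℝ} (hS : ↑S ⊆ indexSet α γ a d)
    (x : EuclideanSpace ℝ S) : ‖trigPoly α γ S a x‖ ≤ ‖x‖ := by
  obtain ⟨y, hy, h⟩ := trigPoly_eq (α := α) (γ := γ) S a x
  refine le_of_sq_le_sq ?_ (norm_nonneg _)
  rw [h, norm_sum_monomial_sq, EuclideanSpace.norm_sq_eq, ← Finset.sum_coe_sort S]
  refine Finset.sum_le_sum fun h _ => ?_
  rw [hy, Complex.norm_real, norm_mul, mul_pow, Real.norm_eq_abs a, sq_abs, ← mul_assoc]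
  refine mul_le_of_le_one_left (sq_nonneg _) ?_
  have h1 : a ^ 2 < (rWeight α γ (h : Fin d → ℤ))⁻¹ := hS h.2
  have hr := rWeight_pos α γ (h : Fin d → ℤ)
  calc _ ≤ rWeight α γ (h : Fin d → ℤ) * (rWeight α γ (h : Fin d → ℤ))⁻¹ := by gcongr
    _ = 1 := mul_inv_cancel₀ hr.ne'

theorem lintegral_error_le {Ω : Type} [MeasurableSpace Ω] {ρ : Measure Ω}
    {A : Korobov α γ d → Ω → L2 d} {ε : ℝ} (hε : 0 ≤ ε)
    (herr : ranError ρ A ≤ ENNReal.ofReal ε) {f : Korobov α γ d} (hf : ‖f‖ ≤ 1) :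
    ∫⁻ ω, ENNReal.ofReal (‖f.toL2 - A f ω‖ ^ 2) ∂ρ ≤ ENNReal.ofReal (ε ^ 2) := by
  have h1 := (le_iSup₂ (f := fun (f : Korobov α γ d) (_ : ‖f‖ ≤ 1) =>
    (∫⁻ ω, ‖f.toL2 - A f ω‖ₑ ^ 2 ∂ρ) ^ (1 / 2 : ℝ)) f hf).trans herr
  have h2 := ENNReal.rpow_le_rpow h1 zero_le_two
  rw [← ENNReal.rpow_mul, ENNReal.ofReal_rpow_of_nonneg hε zero_le_two] at h2
  norm_num at h2
  simpa only [ENNReal.ofReal_pow (norm_nonneg _), ofReal_norm] using h2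

/-- The case of a fixed `ω`. The information is a real-linear map into a space of real dimension
`2n`, so rank-nullity bounds the dimension of its kernel from below, and the algorithm is constant
on the cosets of that kernel. When `2n` exceeds `|S|`, the truncated subtraction makes the bound
trivial. -/
theorem card_sub_mul_le_lintegral {S : Finset (Fin d → ℤ)} [Nonempty S]
    {μ : Measure (EuclideanSpace ℝ S)}
    (hμ : ∀ e : EuclideanSpace ℝ S ≃ₗᵢ[ℝ] EuclideanSpace ℝ S, MeasurePreserving e μ μ)
    (hμ1 : ∀ᵐ x ∂μ, ‖x‖ = 1) (U : EuclideanSpace ℝ S →ₗ[ℝ] Korobov α γ d)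
    (T : EuclideanSpace ℝ S →ₗ[ℝ] L2 d) {κ : ℝ} (hT : ∀ x, ‖T x‖ ^ 2 = κ * ‖x‖ ^ 2)
    {n : ℕ} {L : Fin n → Korobov α γ d → ℂ} (hL : ∀ k, L k ∈ LambdaAll α γ d)
    (φ : (Fin n → ℂ) → L2 d) {g : EuclideanSpace ℝ S → L2 d}
    (hg : ∀ x, g x = φ fun k => L k (U x)) (hm : Measurable fun x => ‖T x - g x‖) :
    ENNReal.ofReal κ * (((S.card - 2 * n : ℕ) : ℝ≥0∞) * μ Set.univ)
      ≤ S.card * ∫⁻ x, ENNReal.ofReal (‖T x - g x‖ ^ 2) ∂μ := by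
  have hS : Module.finrank ℝ (EuclideanSpace ℝ S) = S.card := by simp
  choose M hM using hL
  obtain ⟨N, hN⟩ : ∃ N : EuclideanSpace ℝ S →ₗ[ℝ] (Fin n → ℂ), ∀ x, (fun k => L k (U x)) = N x :=
    ⟨LinearMap.pi fun k => ((M k).toLinearMap.restrictScalars ℝ).comp U,
      fun x => funext fun k => by rw [hM]; rfl⟩
  have hker : S.card - 2 * n ≤ Module.finrank ℝ (LinearMap.ker N) := by
    have h1 := N.finrank_range_add_finrank_ker
    have h2 := Submodule.finrank_le (LinearMap.range N)
    have h3 : Module.finrank ℝ (Fin n → ℂ) = n * 2 := by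
      simp [Module.finrank_pi_fintype, Complex.finrank_real_complex]
    omega
  have key := finrank_mul_le_lintegral hμ hμ1 (LinearMap.ker N) T hT g (fun x x' hx => by
    rw [LinearMap.mem_ker, map_sub, sub_eq_zero] at hx
    rw [hg, hg, hN, hN, hx]) hm
  rw [hS] at key
  refine le_trans ?_ key
  gcongr

/-- Bakhvalov's averaging argument: the bound for each fixed `ω` is integrated over `ω`, and the
double integral is compared with the error bound for each fixed input. -/
theorem card_le_of_ranError_le {Λ : Set (Korobov α γ d → ℂ)}
    (hΛ : Λ ⊆ LambdaAll α γ d) {n : ℕ} {Ω : Type} [MeasurableSpace Ω] {ρ : Measure Ω}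
    {A : Korobov α γ d → Ω → L2 d} (hA : IsRandomizedAlgorithm Λ n ρ A) {ε : ℝ} (hε : 0 < ε)
    (herr : ranError ρ A ≤ ENNReal.ofReal ε) (S : Finset (Fin d → ℤ))
    (hS : ↑S ⊆ indexSet α γ (Real.sqrt 2 * ε) d) : S.card ≤ 4 * n := by
  obtain ⟨hρ, ⟨L, φ, hL, hAL⟩, hmeas⟩ := hA
  rcases S.eq_empty_or_nonempty with rfl | hne
  · simp
  have : Nonempty S := hne.to_subtype
  -- With this scaling the polynomials stay in the unit ball of `H_d`, while their squared `L₂` norm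
  -- on the sphere is `2 ε²`, twice the permitted mean square error.
  set a : ℝ := Real.sqrt 2 * ε with ha
  have ha2 : a ^ 2 = 2 * ε ^ 2 := by rw [ha, mul_pow, Real.sq_sqrt zero_le_two]
  obtain ⟨U, hU⟩ : ∃ U, U = trigPoly α γ S a := ⟨_, rfl⟩
  have hUcont : Continuous U := LinearMap.continuous_of_finiteDimensional U
  obtain ⟨μ, hfin, hμ0, hμ1, hμ⟩ := exists_invariant_measure_sphere (E := EuclideanSpace ℝ S)
  obtain ⟨T, hT⟩ : ∃ T : EuclideanSpace ℝ S →ₗ[ℝ] L2 d, ∀ x, T x = toL2 (U x) :=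
    ⟨(toL2.restrictScalars ℝ).comp U, fun _ => rfl⟩
  have hjoint : Measurable fun q : EuclideanSpace ℝ S × Ω => ‖T q.1 - A (U q.1) q.2‖ := by
    have hg : Measurable fun q : EuclideanSpace ℝ S × Ω => (U q.1, q.2) :=
      (hUcont.measurable.comp measurable_fst).prodMk measurable_snd
    have h1 := hmeas.comp hg
    simpa only [hT, Function.comp_def] using h1
  have hω : ∀ ω, ENNReal.ofReal (a ^ 2) * (((S.card - 2 * n : ℕ) : ℝ≥0∞) * μ Set.univ)
      ≤ S.card * ∫⁻ x, ENNReal.ofReal (‖T x - A (U x) ω‖ ^ 2) ∂μ := fun ω => by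
    have h1 : Measurable fun x : EuclideanSpace ℝ S => ‖T x - A (U x) ω‖ :=
      hjoint.comp (g := fun q : EuclideanSpace ℝ S × Ω => ‖T q.1 - A (U q.1) q.2‖)
        (f := fun x => (x, ω)) measurable_prodMk_right
    exact card_sub_mul_le_lintegral hμ hμ1 U T
      (fun x => by rw [hT, hU, norm_toL2_trigPoly_sq]) (fun k => hΛ (hL k ω)) (φ ω)
      (g := fun x => A (U x) ω) (fun x => hAL (U x) ω) h1
  -- After exchanging the integrals, the inner one is the mean square error at a single input from
  -- the unit ball.
  have htot : ∫⁻ ω, ∫⁻ x, ENNReal.ofReal (‖T x - A (U x) ω‖ ^ 2) ∂μ ∂ρ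
      ≤ ENNReal.ofReal (ε ^ 2) * μ Set.univ := by
    have h1 := measurable_uncurry_ofReal_sq (F := fun x ω => ‖T x - A (U x) ω‖) hjoint
    rw [lintegral_lintegral_swap h1.aemeasurable, ← lintegral_const]
    refine lintegral_mono_ae (hμ1.mono fun x hx => ?_)
    simp only [hT]
    refine lintegral_error_le hε.le herr ?_
    rw [hU, ← hx]
    exact norm_trigPoly_le hS x
  have hfinal : ENNReal.ofReal (a ^ 2) * (((S.card - 2 * n : ℕ) : ℝ≥0∞) * μ Set.univ)
      ≤ S.card * (ENNReal.ofReal (ε ^ 2) * μ Set.univ) := by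
    refine le_trans ?_ (mul_le_mul_right htot _)
    rw [← lintegral_const_mul' _ _ (ENNReal.natCast_ne_top _)]
    refine le_trans (le_of_eq ?_) (lintegral_mono hω)
    rw [lintegral_const, measure_univ (μ := ρ), mul_one]
  have h0 : ENNReal.ofReal (ε ^ 2) * μ Set.univ ≠ 0 :=
    mul_ne_zero (by simpa using hε.ne') hμ0
  have htop : ENNReal.ofReal (ε ^ 2) * μ Set.univ ≠ ⊤ :=
    ENNReal.mul_ne_top ENNReal.ofReal_ne_top (measure_ne_top _ _)
  rw [ha2, ENNReal.ofReal_mul zero_le_two, ENNReal.ofReal_ofNat] at hfinal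
  have h2 : (2 * (S.card - 2 * n : ℕ) : ℝ≥0∞) * (ENNReal.ofReal (ε ^ 2) * μ Set.univ)
      ≤ S.card * (ENNReal.ofReal (ε ^ 2) * μ Set.univ) := by
    convert hfinal using 1
    ring
  have h3 := (ENNReal.mul_le_mul_iff_left h0 htop).mp h2
  -- The factor `2` comes from `a² = 2 ε²`; the inequality `2(|S| - 2n) ≤ |S|` means `|S| ≤ 4n`.
  have h4 : 2 * (S.card - 2 * n) ≤ S.card := by exact_mod_cast h3
  omega

end LowerBound

section Counting

/-! ### Counting the elements of the index sets -/

/-- `∑_m |m|^(-t)` over the nonzero integers `m`. -/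
def zetaInt (t : ℝ) : ℝ := ∑' m : ℤ, |(m : ℝ)| ^ (-t)

theorem zetaInt_nonneg (t : ℝ) : 0 ≤ zetaInt t :=
  tsum_nonneg fun _ => Real.rpow_nonneg (abs_nonneg _) _

variable {α : ℝ} {γ : Weights} {d : ℕ}

/-- Since `0 ^ (-(α * s)) = 0` by convention, the second summand needs no case distinction, and the
sum over all integers is the sum over the nonzero ones. -/
theorem rFactor_rpow_neg (hα : 0 < α) {g s : ℝ} (hg : 0 < g) (hs : 0 < s) (m : ℤ) :
    rFactor α g m ^ (-s) = (if m = 0 then 1 else 0) + g ^ s * |(m : ℝ)| ^ (-(α * s)) := by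
  unfold rFactor
  by_cases h0 : m = 0
  · have : -(α * s) ≠ 0 := by simp [hα.ne', hs.ne']
    simp [h0, Real.zero_rpow this]
  · rw [if_neg h0, if_neg h0, if_neg hα.ne', zero_add,
      Real.mul_rpow (inv_nonneg.mpr hg.le) (Real.rpow_nonneg (abs_nonneg _) _),
      Real.inv_rpow hg.le, Real.rpow_neg hg.le, inv_inv, ← Real.rpow_mul (abs_nonneg _), mul_neg]

theorem hasSum_rFactor_rpow (hα : 0 < α) {g s : ℝ} (hg : 0 < g) (hs : α⁻¹ < s) :
    HasSum (fun m => rFactor α g m ^ (-s)) (1 + g ^ s * zetaInt (α * s)) := by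
  have hs0 : 0 < s := (inv_pos.mpr hα).trans hs
  have h1 : 1 < α * s := by
    have := mul_lt_mul_of_pos_left hs hα
    rwa [mul_inv_cancel₀ hα.ne'] at this
  simp_rw [rFactor_rpow_neg hα hg hs0]
  exact (hasSum_ite_eq 0 1).add ((Real.summable_abs_int_rpow h1).hasSum.mul_left _)

theorem rFactor_nonneg {g : ℝ} (hg : 0 ≤ g) (m : ℤ) : 0 ≤ rFactor α g m := by
  unfold rFactor
  split_ifs <;> positivity

/-- A finite set lies in the product of its coordinate projections. Over that box the sum
factorizes, and each factor is at most the full one-dimensional series. -/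
theorem sum_rWeight_rpow_le (hα : 0 < α) {s : ℝ} (hs : α⁻¹ < s) (S : Finset (Fin d → ℤ)) :
    ∑ h ∈ S, rWeight α γ h ^ (-s)
      ≤ ∏ j : Fin d, (1 + γ.weight j ^ s * zetaInt (α * s)) := by
  classical
  have hnn : ∀ (j : ℕ) (m : ℤ), 0 ≤ rFactor α (γ.weight j) m := fun j m =>
    rFactor_nonneg (γ.pos j).le m
  have hrw : ∀ h : Fin d → ℤ, rWeight α γ h ^ (-s)
      = ∏ j : Fin d, rFactor α (γ.weight j) (h j) ^ (-s) := fun h =>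
    (Real.finsetProd_rpow _ _ (fun j _ => hnn _ _) _).symm
  have hsub : S ⊆ Fintype.piFinset fun j => S.image fun h => h j := fun h hh => by
    rw [Fintype.mem_piFinset]
    exact fun j => Finset.mem_image_of_mem _ hh
  calc _ ≤ ∑ h ∈ Fintype.piFinset fun j => S.image fun h => h j,
        ∏ j : Fin d, rFactor α (γ.weight j) (h j) ^ (-s) := by
        simp_rw [hrw]
        exact Finset.sum_le_sum_of_subset_of_nonneg hsub fun h _ _ =>
          Finset.prod_nonneg fun j _ => Real.rpow_nonneg (hnn _ _) _
    _ = ∏ j : Fin d, ∑ m ∈ S.image fun h => h j, rFactor α (γ.weight j) m ^ (-s) :=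
        (Finset.prod_univ_sum (fun j => S.image fun h => h j)
          fun (j : Fin d) m => rFactor α (γ.weight j) m ^ (-s)).symm
    _ ≤ _ := Finset.prod_le_prod
        (fun j _ => Finset.sum_nonneg fun m _ => Real.rpow_nonneg (hnn _ _) _)
        fun j _ => sum_le_hasSum _ (fun m _ => Real.rpow_nonneg (hnn _ _) _)
          (hasSum_rFactor_rpow hα (γ.pos j) hs)

theorem summable_rWeight_inv (hα : 1 < α) : Summable fun h : Fin d → ℤ => (rWeight α γ h)⁻¹ := by
  have h1 : α⁻¹ < 1 := inv_lt_one_of_one_lt₀ hα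
  refine summable_of_sum_le (c := ∏ j : Fin d, (1 + γ.weight j ^ (1 : ℝ) * zetaInt (α * 1)))
    (fun h => (inv_pos.mpr (rWeight_pos α γ h)).le) fun S => ?_
  have := sum_rWeight_rpow_le (γ := γ) (one_pos.trans hα) h1 S
  simpa only [Real.rpow_neg_one] using this

/-- Markov's inequality: every frequency counted contributes at least `ε^(2s)` to the sum of `r_α(γ,
h)^(-s)`. -/
theorem card_le_of_subset_indexSet (hα : 0 < α) {s : ℝ} (hs : α⁻¹ < s) {ε : ℝ} (hε : 0 < ε)
    (S : Finset (Fin d → ℤ)) (hS : ↑S ⊆ indexSet α γ ε d) :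
    (S.card : ℝ) ≤ (∏ j : Fin d, (1 + γ.weight j ^ s * zetaInt (α * s))) * ε ^ (-(2 * s)) := by
  have hs0 : 0 < s := (inv_pos.mpr hα).trans hs
  have h1 : ∀ h ∈ S, ε ^ (2 * s) ≤ rWeight α γ h ^ (-s) := fun h hh => by
    have h2 : ε ^ 2 < (rWeight α γ h)⁻¹ := hS hh
    rw [Real.rpow_neg (rWeight_pos α γ h).le, ← Real.inv_rpow (rWeight_pos α γ h).le,
      Real.rpow_mul hε.le, Real.rpow_two]
    exact Real.rpow_le_rpow (sq_nonneg _) h2.le hs0.le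
  have h2 := (Finset.card_nsmul_le_sum S _ _ h1).trans (sum_rWeight_rpow_le hα hs S)
  rw [nsmul_eq_mul] at h2
  rw [Real.rpow_neg hε.le, ← div_eq_mul_inv, le_div_iff₀ (Real.rpow_pos_of_pos hε _)]
  exact h2

theorem finite_indexSet (hα : 0 < α) {ε : ℝ} (hε : 0 < ε) : (indexSet α γ ε d).Finite := by
  by_contra hinf
  obtain ⟨s, hs⟩ := exists_gt α⁻¹
  obtain ⟨n, hn⟩ := exists_nat_gt
    ((∏ j : Fin d, (1 + γ.weight j ^ s * zetaInt (α * s))) * ε ^ (-(2 * s)))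
  obtain ⟨S, hS, hcard⟩ := Set.Infinite.exists_subset_card_eq hinf n
  have := card_le_of_subset_indexSet hα hs hε S hS
  rw [hcard] at this
  exact hn.not_ge this

/-- Because all weights are at most `1`, summability passes to larger exponents. -/
theorem exists_summable_of_sumExponent_lt_top (h : sumExponent γ < ⊤) {t : ℝ}
    (ht : (sumExponent γ).toReal < t) : 0 < t ∧ Summable fun j => γ.weight j ^ t := by
  have ht0 : 0 < t := ENNReal.toReal_nonneg.trans_lt ht
  refine ⟨ht0, ?_⟩
  rw [← ENNReal.lt_ofReal_iff_toReal_lt h.ne] at ht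
  simp only [sumExponent, iInf_lt_iff] at ht
  obtain ⟨s, hs0, hs, hst⟩ := ht
  have hst' : s < t := (ENNReal.ofReal_lt_ofReal_iff ht0).mp hst
  refine Summable.of_nonneg_of_le (fun j => Real.rpow_nonneg (γ.pos j).le _) (fun j => ?_) hs
  exact Real.rpow_le_rpow_of_exponent_ge (γ.pos j) (γ.weight_le_one j) hst'.le

theorem sumExponent_le {s : ℝ} (hs0 : 0 < s) (hs : Summable fun j => γ.weight j ^ s) :
    sumExponent γ ≤ ENNReal.ofReal s :=
  iInf_le_of_le s (iInf_le_of_le hs0 (iInf_le _ hs))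

theorem sumExponent_lt_top {s : ℝ} (hs0 : 0 < s) (hs : Summable fun j => γ.weight j ^ s) :
    sumExponent γ < ⊤ := (sumExponent_le hs0 hs).trans_lt ENNReal.ofReal_lt_top

/-- The cardinality bound that is uniform in the dimension. -/
theorem exists_ncard_indexSet_le (hα : 0 < α) (h : sumExponent γ < ⊤) {s : ℝ}
    (hs : max (sumExponent γ).toReal α⁻¹ < s) :
    ∃ C : ℝ, 0 < C ∧ ∀ d : ℕ, ∀ ε : ℝ, 0 < ε →
      ((indexSet α γ ε d).ncard : ℝ) ≤ C * ε ^ (-(2 * s)) := by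
  obtain ⟨hs1, hs2⟩ := max_lt_iff.mp hs
  obtain ⟨-, hsum⟩ := exists_summable_of_sumExponent_lt_top h hs1
  refine ⟨Real.exp (∑' j, γ.weight j ^ s * zetaInt (α * s)), Real.exp_pos _, fun d ε hε => ?_⟩
  have hnn : ∀ j, 0 ≤ γ.weight j ^ s * zetaInt (α * s) := fun j =>
    mul_nonneg (Real.rpow_nonneg (γ.pos j).le _) (zetaInt_nonneg _)
  have hfin := finite_indexSet (γ := γ) (d := d) hα hε
  rw [Set.ncard_eq_toFinset_card _ hfin]
  refine (card_le_of_subset_indexSet (γ := γ) hα hs2 hε hfin.toFinset (by simp)).trans ?_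
  refine mul_le_mul_of_nonneg_right ?_ (Real.rpow_nonneg hε.le _)
  -- The inequality `1 + x ≤ exp x` turns the product into a sum, which is bounded by the infinite
  -- series independently of `d`.
  calc _ ≤ ∏ j : Fin d, Real.exp (γ.weight j ^ s * zetaInt (α * s)) :=
        Finset.prod_le_prod (fun j _ => by linarith [hnn j]) fun j _ => by
          linarith [Real.add_one_le_exp (γ.weight j ^ s * zetaInt (α * s))]
    _ = Real.exp (∑ j ∈ Finset.range d, γ.weight j ^ s * zetaInt (α * s)) := by
        rw [← Real.exp_sum, Fin.sum_univ_eq_sum_range fun j => γ.weight j ^ s * zetaInt (α * s)]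
    _ ≤ _ := Real.exp_le_exp.mpr ((hsum.mul_right _).sum_le_tsum _ fun j _ => hnn j)

end Counting

/-! ### Tractability in the class of all continuous linear functionals -/

section Complexity

variable {α : ℝ} {γ : Weights} {d : ℕ}

theorem ranError_le {Ω : Type} [MeasurableSpace Ω] {ρ : Measure Ω}
    {A : Korobov α γ d → Ω → L2 d} {ε : ℝ} (hε : 0 ≤ ε)
    (h : ∀ f : Korobov α γ d, ‖f‖ ≤ 1 →
      ∫⁻ ω, ENNReal.ofReal (‖f.toL2 - A f ω‖ ^ 2) ∂ρ ≤ ENNReal.ofReal (ε ^ 2)) :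
    ranError ρ A ≤ ENNReal.ofReal ε := by
  refine iSup₂_le fun f hf => ?_
  have h1 := ENNReal.rpow_le_rpow (h f hf) (by norm_num : (0 : ℝ) ≤ 1 / 2)
  rw [ENNReal.ofReal_rpow_of_nonneg (sq_nonneg _) (by norm_num), ← Real.sqrt_eq_rpow,
    Real.sqrt_sq hε] at h1
  simpa only [ENNReal.ofReal_pow (norm_nonneg _), ofReal_norm] using h1

theorem compRan_le {Λ : Set (Korobov α γ d → ℂ)} {n : ℕ} {Ω : Type} [MeasurableSpace Ω]
    {ρ : Measure Ω} {A : Korobov α γ d → Ω → L2 d} (hA : IsRandomizedAlgorithm Λ n ρ A) {ε : ℝ}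
    (herr : ranError ρ A ≤ ENNReal.ofReal ε) : compRan ε Λ ≤ n :=
  iInf₂_le n ⟨Ω, _, ρ, A, hA, herr⟩

/-- A finite infimum of natural numbers is attained, so a bound on the complexity provides an actual
algorithm. -/
theorem exists_algorithm_of_compRan_le {Λ : Set (Korobov α γ d → ℂ)} {ε x : ℝ} (hx : 0 ≤ x)
    (h : (compRan ε Λ : ℝ≥0∞) ≤ ENNReal.ofReal x) :
    ∃ n : ℕ, (n : ℝ) ≤ x ∧ ∃ (Ω : Type) (_ : MeasurableSpace Ω) (ρ : Measure Ω)
      (A : Korobov α γ d → Ω → L2 d),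
      IsRandomizedAlgorithm Λ n ρ A ∧ ranError ρ A ≤ ENNReal.ofReal ε := by
  have htop : compRan ε Λ ≠ ⊤ := fun h0 => by simp [h0] at h
  obtain ⟨c, hc⟩ := ENat.ne_top_iff_exists.mp htop
  have hlt : compRan ε Λ < ((c + 1 : ℕ) : ℕ∞) := by
    rw [← hc]
    exact_mod_cast Nat.lt_succ_self c
  rw [compRan] at hlt
  simp only [iInf_lt_iff] at hlt
  obtain ⟨n, hn, hlt⟩ := hlt
  have hnc : n ≤ c := Nat.lt_succ_iff.mp (by exact_mod_cast hlt)
  refine ⟨n, ?_, hn⟩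
  rw [← hc, ENat.toENNReal_coe, ← ENNReal.ofReal_natCast,
    ENNReal.ofReal_le_ofReal_iff hx] at h
  exact le_trans (by exact_mod_cast hnc) h

theorem compRan_anti {Λ Λ' : Set (Korobov α γ d → ℂ)} (h : Λ ⊆ Λ') (ε : ℝ) :
    compRan ε Λ' ≤ compRan ε Λ := by
  refine le_iInf₂ fun n hn => ?_
  obtain ⟨Ω, _, ρ, A, ⟨h1, ⟨L, φ, hL, hA⟩, h2⟩, herr⟩ := hn
  exact compRan_le ⟨h1, ⟨L, φ, fun k ω => h (hL k ω), hA⟩, h2⟩ herr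

open Korobov in
-- The truncated Fourier series, viewed as a randomized algorithm over a one-point probability
-- space; only the tail contributes to its error.
theorem compRan_all_le (hα : 0 ≤ α) {ε : ℝ} (hε : 0 ≤ ε) (hfin : (indexSet α γ ε d).Finite) :
    compRan ε (LambdaAll α γ d) ≤ ((indexSet α γ ε d).ncard : ℕ∞) := by
  rw [Set.ncard_eq_toFinset_card _ hfin]
  set S := hfin.toFinset
  let A : Korobov α γ d → Unit → L2 d := fun f _ =>
    ∑ h ∈ S, coeff f.toL2 h • UnitAddTorus.mFourierLp 2 h
  have hA : IsRandomizedAlgorithm (LambdaAll α γ d) S.card (Measure.dirac ()) A := by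
    refine ⟨inferInstance, ⟨fun k _ => coeffCLM hα (S.equivFin.symm k : Fin d → ℤ),
      fun _ v => ∑ h : S, v (S.equivFin h) • UnitAddTorus.mFourierLp 2 (h : Fin d → ℤ),
      fun k _ => ⟨_, rfl⟩, fun f _ => ?_⟩, ?_⟩
    · simp only [A, Equiv.symm_apply_apply, coeffCLM_apply]
      exact (Finset.sum_coe_sort S fun h => coeff f.toL2 h • UnitAddTorus.mFourierLp 2 h).symm
    · have h1 : Continuous fun f : Korobov α γ d =>
          ‖f.toL2 - ∑ h ∈ S, coeffCLM hα h f • UnitAddTorus.mFourierLp (d := Fin d) 2 h‖ := by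
        refine ((continuous_toL2 hα).sub (continuous_finsetSum _ fun h _ => ?_)).norm
        exact (coeffCLM hα h).continuous.smul continuous_const
      exact h1.measurable.comp measurable_fst
  refine compRan_le hA (ranError_le hε fun f hf => ?_)
  rw [lintegral_dirac]
  refine ENNReal.ofReal_le_ofReal ?_
  refine (norm_sub_sum_sq_le f S _ (sq_nonneg ε) fun h hh => ?_).trans ?_
  · have : ¬ (rWeight α γ h)⁻¹ > ε ^ 2 := by simpa [S, indexSet] using hh
    exact not_lt.mp this
  · simp only [sub_self, norm_zero, ne_eq, OfNat.ofNat_ne_zero, not_false_eq_true, zero_pow,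
      Finset.sum_const_zero, zero_add]
    exact mul_le_of_le_one_right (sq_nonneg _) (pow_le_one₀ (norm_nonneg _) hf)

end Complexity

/-! ### Necessary conditions from counting, and the exponent for `Λ^all`. -/

section TractabilityAll

variable {α : ℝ} {γ : Weights} {Λ : (d : ℕ) → Set (Korobov α γ d → ℂ)}

theorem CompBound.mono {C p p' q : ℝ} (h : CompBound Λ C p q) (hC : 0 ≤ C) (hp : p ≤ p') :
    CompBound Λ C p' q := fun ε hε0 hε1 d hd => by
  refine (h ε hε0 hε1 d hd).trans (ENNReal.ofReal_le_ofReal ?_)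
  have : ε ^ (-p) ≤ ε ^ (-p') :=
    Real.rpow_le_rpow_of_exponent_ge hε0 hε1.le (neg_le_neg hp)
  gcongr

theorem CompBound.anti {Λ' : (d : ℕ) → Set (Korobov α γ d → ℂ)} (hΛ : ∀ d, Λ d ⊆ Λ' d)
    {C p q : ℝ} (h : CompBound Λ C p q) : CompBound Λ' C p q := fun ε hε0 hε1 d hd =>
  le_trans (by exact_mod_cast compRan_anti (hΛ d) ε) (h ε hε0 hε1 d hd)

theorem StronglyTractable.tractable (h : StronglyTractable Λ) : Tractable Λ := by
  obtain ⟨C, p, hC, hp, h⟩ := h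
  exact ⟨C, p, 0, hC, hp, le_rfl, h⟩

/-- This turns a complexity bound into a counting bound; all necessary conditions below follow by
choosing a suitable `S`. -/
theorem CompBound.card_le (hΛ : ∀ d, Λ d ⊆ LambdaAll α γ d) {C p q : ℝ} (hC : 0 ≤ C)
    (h : CompBound Λ C p q) {d : ℕ} (hd : 1 ≤ d) {τ : ℝ} (hτ0 : 0 < τ) (hτ1 : τ ≤ 1)
    (S : Finset (Fin d → ℤ)) (hS : ∀ h ∈ S, τ < (rWeight α γ h)⁻¹) :
    (S.card : ℝ) ≤ 4 * C * 2 ^ (p / 2) * τ ^ (-(p / 2)) * (d : ℝ) ^ q := by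
  -- Chosen so that `(√2 ε)² = τ`, the threshold in the lower bound for algorithms.
  set ε := Real.sqrt (τ / 2) with hε
  have hε0 : 0 < ε := Real.sqrt_pos.mpr (half_pos hτ0)
  have hsq : ε ^ 2 = τ / 2 := Real.sq_sqrt (half_pos hτ0).le
  have hε1 : ε < 1 := by nlinarith
  have hpow : ε ^ (-p) = 2 ^ (p / 2) * τ ^ (-(p / 2)) := by
    rw [hε, Real.sqrt_eq_rpow, ← Real.rpow_mul (half_pos hτ0).le,
      Real.div_rpow hτ0.le zero_le_two, div_eq_mul_inv, ← Real.rpow_neg zero_le_two, mul_comm]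
    congr 2 <;> ring
  have hx : 0 ≤ C * ε ^ (-p) * (d : ℝ) ^ q := by positivity
  obtain ⟨n, hn, Ω, _, ρ, A, hA, herr⟩ :=
    exists_algorithm_of_compRan_le hx (h ε hε0 hε1 d hd)
  have hcard := card_le_of_ranError_le (hΛ d) hA hε0 herr S fun k hk => by
    have h1 : (Real.sqrt 2 * ε) ^ 2 = τ := by
      rw [mul_pow, Real.sq_sqrt zero_le_two, hsq]; ring
    have h2 := hS k hk
    rw [← h1] at h2
    exact h2
  calc (S.card : ℝ) ≤ 4 * n := by exact_mod_cast hcard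
    _ ≤ 4 * (C * ε ^ (-p) * (d : ℝ) ^ q) := by gcongr
    _ = _ := by rw [hpow]; ring

/-- For `α = 0` every frequency has weight `1`, so already in dimension one infinitely many of them
exceed the threshold `1/2`. -/
theorem CompBound.pos_of_nonneg (hα : 0 ≤ α) (hΛ : ∀ d, Λ d ⊆ LambdaAll α γ d) {C p q : ℝ}
    (hC : 0 ≤ C) (h : CompBound Λ C p q) : 0 < α := by
  refine hα.lt_of_ne fun h0 => ?_
  subst h0
  obtain ⟨n, hn⟩ := exists_nat_gt
    (4 * C * 2 ^ (p / 2) * (1 / 2 : ℝ) ^ (-(p / 2)) * ((1 : ℕ) : ℝ) ^ q)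
  obtain ⟨S, hS⟩ := Infinite.exists_subset_card_eq (Fin 1 → ℤ) n
  have h1 := h.card_le hΛ hC le_rfl one_half_pos (by norm_num) S fun k _ => by
    have : rWeight 0 γ k = 1 := Finset.prod_eq_one fun j _ => by simp [rFactor]
    rw [this]
    norm_num
  rw [hS] at h1
  exact hn.not_ge h1

/-- In dimension one the frequencies `1, …, M` give `M ≤ K M^(α p / 2)` for all `M`, which is
impossible when `α p < 2`. -/
theorem CompBound.two_div_le (hα : 0 < α) (hΛ : ∀ d, Λ d ⊆ LambdaAll α γ d) {C p : ℝ}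
    (hC : 0 ≤ C) (h : CompBound Λ C p 0) : 2 * α⁻¹ ≤ p := by
  by_contra! hp
  have hθ : 0 < 1 - α * (p / 2) := by
    have : α * p < 2 := by
      calc α * p < α * (2 * α⁻¹) := by gcongr
        _ = 2 := by field_simp
    linarith
  set K := 4 * C * 2 ^ (p / 2) * (γ.weight 0 / 2) ^ (-(p / 2)) with hK
  have key : ∀ M : ℕ, 1 ≤ M → (M : ℝ) ^ (1 - α * (p / 2)) ≤ K := fun M hM => by
    have hM0 : (0 : ℝ) < M := by exact_mod_cast hM
    have hM1 : (1 : ℝ) ≤ M := by exact_mod_cast hM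
    have hg := γ.pos 0
    -- Half of `r⁻¹` at the frequency `M`; the factor `1/2` makes the inequality strict.
    set τ := γ.weight 0 / 2 * (M : ℝ) ^ (-α) with hτ
    have hτ0 : 0 < τ := by positivity
    have hτ1 : τ ≤ 1 := mul_le_one₀ (by linarith [γ.le_one]) (by positivity)
      (Real.rpow_le_one_of_one_le_of_nonpos hM1 (by linarith))
    have hinj : Function.Injective fun (m : ℕ) (_ : Fin 1) => ((m + 1 : ℕ) : ℤ) := fun a b hab => by
      simpa using congrFun hab 0
    have h1 := h.card_le hΛ hC le_rfl hτ0 hτ1 ((Finset.range M).map ⟨_, hinj⟩) fun k hk => by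
      obtain ⟨m, hm, rfl⟩ := Finset.mem_map.mp hk
      have hmM : ((m + 1 : ℕ) : ℝ) ≤ M := by exact_mod_cast Finset.mem_range.mp hm
      have hm0 : (0 : ℝ) < ((m + 1 : ℕ) : ℝ) := by positivity
      have hr : (rWeight α γ fun _ : Fin 1 => ((m + 1 : ℕ) : ℤ))⁻¹
          = γ.weight 0 * ((m + 1 : ℕ) : ℝ) ^ (-α) := by
        simp only [rWeight, Finset.univ_unique, Finset.prod_singleton, rFactor, hα.ne', if_false]
        rw [if_neg (by exact_mod_cast Nat.succ_ne_zero m), mul_inv, inv_inv, Int.cast_natCast,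
          abs_of_pos hm0, Real.rpow_neg hm0.le]
        simp
      change τ < (rWeight α γ fun _ : Fin 1 => ((m + 1 : ℕ) : ℤ))⁻¹
      rw [hr]
      have h2 : (M : ℝ) ^ (-α) ≤ ((m + 1 : ℕ) : ℝ) ^ (-α) :=
        Real.rpow_le_rpow_of_nonpos hm0 hmM (by linarith)
      have h3 : 0 < (M : ℝ) ^ (-α) := by positivity
      calc τ < γ.weight 0 * (M : ℝ) ^ (-α) := by rw [hτ]; nlinarith [mul_pos hg h3]
        _ ≤ _ := by gcongr
    rw [Finset.card_map, Finset.card_range, Real.rpow_zero, mul_one, hτ,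
      Real.mul_rpow (by positivity) (by positivity), ← Real.rpow_mul hM0.le] at h1
    rw [Real.rpow_sub hM0, Real.rpow_one, div_le_iff₀ (by positivity)]
    calc (M : ℝ) ≤ _ := h1
      _ = _ := by rw [hK, neg_mul_neg]; ring
  have htend := (tendsto_rpow_atTop hθ).comp tendsto_natCast_atTop_atTop
  obtain ⟨M, hM⟩ := ((htend.eventually_gt_atTop K).and (Filter.eventually_ge_atTop 1)).exists
  exact hM.1.not_ge (key M hM.2)

/-- Counting the `0/1`-vectors with exactly `k` ones. -/
theorem CompBound.choose_le (hα : 0 < α) (hΛ : ∀ d, Λ d ⊆ LambdaAll α γ d) {C p q : ℝ}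
    (hC : 0 ≤ C) (h : CompBound Λ C p q) (k n : ℕ) :
    ((n + 1).choose k : ℝ)
      ≤ 4 * C * 2 ^ (p / 2) * (γ.weight n ^ k / 2) ^ (-(p / 2)) * ((n + 1 : ℕ) : ℝ) ^ q := by
  classical
  have hg := γ.pos n
  have hinj : Function.Injective fun (s : Finset (Fin (n + 1))) (j : Fin (n + 1)) =>
      if j ∈ s then (1 : ℤ) else 0 := fun s t hst => by
    ext j
    have := congrFun hst j
    by_cases h1 : j ∈ s <;> by_cases h2 : j ∈ t <;> simp_all
  -- Among the first `n + 1` weights `γ.weight n` is the smallest, so `k` ones give `r⁻¹ ≥ γ.weight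
  -- n ^ k`; halving makes the threshold strict.
  have h1 := h.card_le hΛ hC (Nat.le_add_left 1 n) (τ := γ.weight n ^ k / 2) (by positivity)
    (by linarith [pow_le_one₀ (n := k) hg.le (γ.weight_le_one n)])
    ((Finset.univ.powersetCard k).map ⟨_, hinj⟩) fun u hu => by
      obtain ⟨s, hs, rfl⟩ := Finset.mem_map.mp hu
      have hsk : s.card = k := (Finset.mem_powersetCard.mp hs).2
      have hr : (rWeight α γ fun j : Fin (n + 1) => if j ∈ s then (1 : ℤ) else 0)⁻¹
          = ∏ j ∈ s, γ.weight j := by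
        rw [rWeight, ← Finset.prod_inv_distrib, ← Finset.prod_subset (Finset.subset_univ s)]
        · exact Finset.prod_congr rfl fun j hj => by simp [rFactor, hj, hα.ne']
        · intro j _ hj
          simp [rFactor, hj]
      change _ < (rWeight α γ fun j : Fin (n + 1) => if j ∈ s then (1 : ℤ) else 0)⁻¹
      rw [hr]
      calc γ.weight n ^ k / 2 < γ.weight n ^ k := half_lt_self (by positivity)
        _ = ∏ j ∈ s, γ.weight n := by rw [Finset.prod_const, hsk]
        _ ≤ _ := Finset.prod_le_prod (fun _ _ => hg.le) fun j _ =>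
          γ.anti (Nat.lt_succ_iff.mp j.2)
  simpa using h1

/-- For `n ≥ 2k` one has `n + 1 - k ≥ n/2` in `(n + 1 - k)^k / k! ≤ n.choose k`. -/
theorem exists_pow_le_choose (k : ℕ) :
    ∃ c : ℝ, 0 < c ∧ ∀ n : ℕ, 2 * k ≤ n → c * (n : ℝ) ^ k ≤ n.choose k := by
  refine ⟨(2 ^ k * k.factorial : ℝ)⁻¹, by positivity, fun n hn => ?_⟩
  refine le_trans ?_ (Nat.pow_le_choose (α := ℝ) k n)
  have h1 : (n : ℝ) ≤ 2 * ((n + 1 - k : ℕ) : ℝ) := by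
    have : n ≤ 2 * (n + 1 - k) := by omega
    exact_mod_cast this
  rw [inv_mul_eq_div, mul_comm (2 ^ k : ℝ), div_mul_eq_div_div_swap, ← div_pow]
  have h2 : (n : ℝ) / 2 ≤ ((n + 1 - k : ℕ) : ℝ) := by linarith
  gcongr

/-- With `N = n + 1`, counting gives `c N^k ≤ B N^q γ.weight n ^ (-k p / 2)`. The choice `k ≥ q + 1`
leaves at least one power of `N` after `N^q` is absorbed. -/
theorem CompBound.exists_weight_rpow_le (hα : 0 < α) (hΛ : ∀ d, Λ d ⊆ LambdaAll α γ d)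
    {C p q : ℝ} (hC : 0 ≤ C) (hp : 0 ≤ p) (h : CompBound Λ C p q) {k : ℕ} (hk : q + 1 ≤ k) :
    ∃ K : ℝ, 0 ≤ K ∧ ∀ n : ℕ, γ.weight n ^ (k * (p / 2)) ≤ K / (n + 1 : ℕ) := by
  obtain ⟨c, hc, hck⟩ := exists_pow_le_choose k
  set B := 4 * C * 2 ^ (p / 2) * (1 / 2 : ℝ) ^ (-(p / 2)) with hB
  have hB0 : 0 ≤ B := by positivity
  refine ⟨max (B / c) (2 * k), le_max_of_le_right (by positivity), fun n => ?_⟩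
  have hn0 : (0 : ℝ) < (n + 1 : ℕ) := by positivity
  have hn1 : (1 : ℝ) ≤ (n + 1 : ℕ) := by exact_mod_cast Nat.le_add_left 1 n
  have hg := γ.pos n
  rw [le_div_iff₀ hn0]
  rcases lt_or_ge (n + 1) (2 * k) with hlt | hge
  -- For `n + 1 < 2k` the binomial estimate is unavailable, but the weights are at most `1`.
  · refine le_max_of_le_right ?_
    have h1 : γ.weight n ^ (k * (p / 2)) ≤ 1 :=
      Real.rpow_le_one hg.le (γ.weight_le_one n) (by positivity)
    have h2 : ((n + 1 : ℕ) : ℝ) ≤ 2 * k := by exact_mod_cast hlt.le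
    nlinarith
  · refine le_max_of_le_left ?_
    have h1 := (hck _ hge).trans (h.choose_le hα hΛ hC k n)
    have h2 : (γ.weight n ^ k / 2) ^ (-(p / 2))
        = (1 / 2 : ℝ) ^ (-(p / 2)) * (γ.weight n ^ (k * (p / 2)))⁻¹ := by
      rw [div_eq_mul_one_div, Real.mul_rpow (by positivity) (by norm_num), ← Real.rpow_natCast,
        ← Real.rpow_mul hg.le, mul_neg, Real.rpow_neg hg.le, mul_comm]
    have h3 : ((n + 1 : ℕ) : ℝ) ^ q * (n + 1 : ℕ) ≤ ((n + 1 : ℕ) : ℝ) ^ k := by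
      rw [← Real.rpow_natCast, ← Real.rpow_add_one hn0.ne']
      exact Real.rpow_le_rpow_of_exponent_le hn1 hk
    have hw : 0 < γ.weight n ^ (k * (p / 2)) := by positivity
    have hq : 0 < ((n + 1 : ℕ) : ℝ) ^ q := by positivity
    rw [h2] at h1
    rw [le_div_iff₀ hc]
    have h4 : c * ((n + 1 : ℕ) : ℝ) ^ k * γ.weight n ^ (k * (p / 2))
        ≤ B * ((n + 1 : ℕ) : ℝ) ^ q := by
      refine (mul_le_mul_of_nonneg_right h1 hw.le).trans (le_of_eq ?_)
      rw [hB]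
      field_simp
    have h5 : c * (((n + 1 : ℕ) : ℝ) ^ q * (n + 1 : ℕ)) * γ.weight n ^ (k * (p / 2))
        ≤ B * ((n + 1 : ℕ) : ℝ) ^ q := le_trans (by gcongr) h4
    refine le_of_mul_le_mul_right (le_trans (le_of_eq ?_) h5) hq
    ring

/-- Raising the decay estimate to the power `θ > 1` gives a convergent majorant `∑ N^(-θ)`. -/
theorem CompBound.summable_weight_rpow (hα : 0 < α) (hΛ : ∀ d, Λ d ⊆ LambdaAll α γ d)
    {C p q : ℝ} (hC : 0 ≤ C) (hp : 0 < p) (hq : 0 ≤ q) (h : CompBound Λ C p q) {k : ℕ}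
    (hk : q + 1 ≤ k) {s : ℝ} (hs : k * (p / 2) < s) : Summable fun j => γ.weight j ^ s := by
  obtain ⟨K, hK0, hK⟩ := h.exists_weight_rpow_le hα hΛ hC hp.le hk
  have hk0 : (0 : ℝ) < k := by linarith
  have ht : 0 < k * (p / 2) := by positivity
  set θ := s / (k * (p / 2)) with hθ
  have hθ1 : 1 < θ := (one_lt_div ht).mpr hs
  have hsum : Summable fun j : ℕ => K ^ θ * (1 / ((j + 1 : ℕ) : ℝ) ^ θ) :=
    ((summable_nat_add_iff 1).mpr (Real.summable_one_div_nat_rpow.mpr hθ1)).mul_left _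
  refine Summable.of_nonneg_of_le (fun j => Real.rpow_nonneg (γ.pos j).le _) (fun j => ?_) hsum
  have h1 := Real.rpow_le_rpow (Real.rpow_nonneg (γ.pos j).le _) (hK j) (by linarith : 0 ≤ θ)
  rw [← Real.rpow_mul (γ.pos j).le, hθ, mul_div_cancel₀ _ ht.ne', ← hθ,
    Real.div_rpow hK0 (by positivity)] at h1
  rwa [mul_one_div]

theorem Tractable.sumExponent_lt_top (hα : 0 < α) (hΛ : ∀ d, Λ d ⊆ LambdaAll α γ d)
    (h : Tractable Λ) : sumExponent γ < ⊤ := by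
  obtain ⟨C, p, q, hC, hp, hq, h⟩ := h
  obtain ⟨k, hk⟩ := exists_nat_ge (q + 1)
  have hs : k * ((p + 1) / 2) < k * ((p + 1) / 2) + 1 := lt_add_one _
  exact WeightedKorobov.sumExponent_lt_top (by positivity)
    -- Passing from `p` to `p + 1` makes the exponent positive.
    ((h.mono hC (le_add_of_nonneg_right zero_le_one)).summable_weight_rpow hα hΛ hC
      (by linarith) hq hk hs)

/-- With `q = 0` the choice `k = 1` is allowed; it makes every `s > p/2` admissible and so gives the
sharp bound `s_γ ≤ p/2`. -/
theorem CompBound.two_mul_max_le (hα : 0 < α) (hΛ : ∀ d, Λ d ⊆ LambdaAll α γ d) {C p : ℝ}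
    (hC : 0 ≤ C) (h : CompBound Λ C p 0) : 2 * max (sumExponent γ).toReal α⁻¹ ≤ p := by
  have h1 := h.two_div_le hα hΛ hC
  have hp : 0 < p := lt_of_lt_of_le (by positivity) h1
  have h2 : (sumExponent γ).toReal ≤ p / 2 := by
    refine le_of_forall_gt_imp_ge_of_dense fun s hs => ?_
    have hs0 : 0 < s := (half_pos hp).trans hs
    refine ENNReal.toReal_le_of_le_ofReal hs0.le (sumExponent_le hs0 ?_)
    exact h.summable_weight_rpow hα hΛ hC hp le_rfl (k := 1) (by norm_num) (by simpa using hs)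
  rw [mul_max_of_nonneg _ _ zero_le_two]
  exact max_le (by linarith) h1

theorem exists_compBound_all (hα : 0 < α) (h : sumExponent γ < ⊤) {p : ℝ}
    (hp : 2 * max (sumExponent γ).toReal α⁻¹ < p) :
    ∃ C : ℝ, 0 ≤ C ∧ CompBound (LambdaAll α γ) C p 0 := by
  obtain ⟨C, hC, hcard⟩ := exists_ncard_indexSet_le hα h (s := p / 2) (by linarith)
  refine ⟨C, hC.le, fun ε hε0 hε1 d hd => ?_⟩
  have h1 : (compRan ε (LambdaAll α γ d) : ℝ≥0∞) ≤ ((indexSet α γ ε d).ncard : ℝ≥0∞) := by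
    exact_mod_cast compRan_all_le hα.le hε0.le (finite_indexSet hα hε0)
  refine h1.trans ?_
  rw [← ENNReal.ofReal_natCast, Real.rpow_zero, mul_one]
  refine ENNReal.ofReal_le_ofReal ((hcard d ε hε0).trans (le_of_eq ?_))
  rw [mul_div_cancel₀ _ two_ne_zero]

theorem max_sumExponent_nonneg (hα : 0 < α) : 0 ≤ 2 * max (sumExponent γ).toReal α⁻¹ := by
  positivity

theorem stronglyTractable_all (hα : 0 < α) (h : sumExponent γ < ⊤) :
    StronglyTractable (LambdaAll α γ) := by
  obtain ⟨C, hC, hb⟩ := exists_compBound_all hα h (lt_add_one _)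
  exact ⟨C, _, hC, by linarith [max_sumExponent_nonneg (γ := γ) hα], hb⟩

theorem strongExponent_all (hα : 0 < α) (h : sumExponent γ < ⊤) :
    strongExponent (LambdaAll α γ) = 2 * max (sumExponent γ).toReal α⁻¹ := by
  have h0 := max_sumExponent_nonneg (γ := γ) hα
  have hlb : 2 * max (sumExponent γ).toReal α⁻¹ ∈ lowerBounds
      {p : ℝ | 0 ≤ p ∧ ∃ C : ℝ, 0 ≤ C ∧ CompBound (LambdaAll α γ) C p 0} := by
    rintro p ⟨-, C, hC, hb⟩
    exact hb.two_mul_max_le hα (fun _ => subset_rfl) hC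
  refine le_antisymm (le_of_forall_gt_imp_ge_of_dense fun p hp => ?_) ?_
  · obtain ⟨C, hC, hb⟩ := exists_compBound_all hα h hp
    exact csInf_le ⟨_, hlb⟩ ⟨h0.trans hp.le, C, hC, hb⟩
  · obtain ⟨C, p, hC, hp, hb⟩ := stronglyTractable_all hα h
    exact le_csInf ⟨p, hp, C, hC, hb⟩ hlb

end TractabilityAll

/-! ### Function values -/

instance isProbabilityMeasure_unitAddCircle :
    IsProbabilityMeasure (volume : Measure UnitAddCircle) :=
  inferInstanceAs (IsProbabilityMeasure AddCircle.haarAddCircle)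

instance isAddHaarMeasure_unitAddCircle :
    (volume : Measure UnitAddCircle).IsAddHaarMeasure :=
  inferInstanceAs AddCircle.haarAddCircle.IsAddHaarMeasure

namespace Korobov

variable {α : ℝ} {γ : Weights} {d : ℕ}

/-- By the inequality of the means, `|f̂(h)| ≤ r⁻¹ + r |f̂(h)|²`, and `∑ r⁻¹` converges for `α > 1`.
-/
theorem summable_norm_coeff (hα : 1 < α) (f : Korobov α γ d) :
    Summable fun h => ‖coeff (toL2 f) h‖ := by
  refine Summable.of_nonneg_of_le (fun _ => norm_nonneg _) (fun h => ?_)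
    ((summable_rWeight_inv (γ := γ) hα).add f.summable)
  have hr := rWeight_pos α γ h
  have h1 : rWeight α γ h * (rWeight α γ h)⁻¹ = 1 := mul_inv_cancel₀ hr.ne'
  have h2 : 0 < (rWeight α γ h)⁻¹ := inv_pos.mpr hr
  nlinarith [mul_nonneg hr.le (sq_nonneg (‖coeff (toL2 f) h‖ - (rWeight α γ h)⁻¹)),
    norm_nonneg (coeff (toL2 f) h)]

/-- Summing `r (|f̂(h)| - r⁻¹ ‖f‖)² ≥ 0` gives a bound linear in `‖f‖`. The constant is not sharp;
only continuity of the embedding into continuous functions is needed. -/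
theorem tsum_norm_coeff_le (hα : 1 < α) (f : Korobov α γ d) :
    ∑' h, ‖coeff (toL2 f) h‖ ≤ ((∑' h : Fin d → ℤ, (rWeight α γ h)⁻¹) + 1) / 2 * ‖f‖ := by
  rcases eq_or_ne f 0 with rfl | hf
  · simp [coeff_zero]
  have hf0 : 0 < ‖f‖ := norm_pos_iff.mpr hf
  have h1 : ∀ h, ‖coeff (toL2 f) h‖ * (2 * ‖f‖)
      ≤ (rWeight α γ h)⁻¹ * ‖f‖ ^ 2 + rWeight α γ h * ‖coeff (toL2 f) h‖ ^ 2 := fun h => by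
    have hr := rWeight_pos α γ h
    have h1 : rWeight α γ h * (rWeight α γ h)⁻¹ = 1 := mul_inv_cancel₀ hr.ne'
    have h2 := mul_nonneg hr.le
      (sq_nonneg (‖coeff (toL2 f) h‖ - (rWeight α γ h)⁻¹ * ‖f‖))
    have h3 : rWeight α γ h * (‖coeff (toL2 f) h‖ - (rWeight α γ h)⁻¹ * ‖f‖) ^ 2
        = rWeight α γ h * ‖coeff (toL2 f) h‖ ^ 2
          - rWeight α γ h * (rWeight α γ h)⁻¹ * (‖coeff (toL2 f) h‖ * (2 * ‖f‖))
          + rWeight α γ h * (rWeight α γ h)⁻¹ * ((rWeight α γ h)⁻¹ * ‖f‖ ^ 2) := by ring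
    rw [h3, h1] at h2
    linarith
  have h2 := hasSum_le h1 ((summable_norm_coeff hα f).hasSum.mul_right (2 * ‖f‖))
    (((summable_rWeight_inv hα).hasSum.mul_right (‖f‖ ^ 2)).add f.hasSum_norm_sq)
  refine le_of_mul_le_mul_right (h2.trans (le_of_eq ?_)) (by positivity : 0 < 2 * ‖f‖)
  ring

theorem summable_fourierSeries (hα : 1 < α) (f : Korobov α γ d) :
    Summable fun h => coeff (toL2 f) h • UnitAddTorus.mFourier h := by
  refine Summable.of_norm ?_
  simpa only [norm_smul, UnitAddTorus.mFourier_norm, mul_one] using summable_norm_coeff hα f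

/-- The continuous representative, for `α > 1`, as a continuous linear map. -/
def rep (hα : 1 < α) : Korobov α γ d →L[ℂ] C(UnitAddTorus (Fin d), ℂ) :=
  LinearMap.mkContinuous
    { toFun := fun f => ∑' h, coeff (toL2 f) h • UnitAddTorus.mFourier h
      map_add' := fun f g => by
        rw [← (summable_fourierSeries hα f).tsum_add (summable_fourierSeries hα g)]
        refine tsum_congr fun h => ?_
        rw [map_add, coeff_add]
        ext x
        exact add_mul _ _ _
      map_smul' := fun c f => by
        rw [RingHom.id_apply, ← (summable_fourierSeries hα f).tsum_const_smul]
        refine tsum_congr fun h => ?_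
        rw [map_smul, coeff_smul, mul_smul] }
    (((∑' h : Fin d → ℤ, (rWeight α γ h)⁻¹) + 1) / 2) fun f => by
      have h1 : ∀ h, ‖coeff (toL2 f) h • UnitAddTorus.mFourier h‖ = ‖coeff (toL2 f) h‖ := fun h => by
        rw [norm_smul, UnitAddTorus.mFourier_norm, mul_one]
      have h2 := norm_tsum_le_tsum_norm (f := fun h => coeff (toL2 f) h • UnitAddTorus.mFourier h)
        (by simpa only [h1] using summable_norm_coeff hα f)
      simp only [h1] at h2
      exact h2.trans (tsum_norm_coeff_le hα f)

theorem hasSum_rep (hα : 1 < α) (f : Korobov α γ d) :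
    HasSum (fun h => coeff (toL2 f) h • UnitAddTorus.mFourier h) (rep hα f) :=
  (summable_fourierSeries hα f).hasSum

/-- Uniform convergence of the Fourier series implies `L₂` convergence, where its limit is `f`. -/
theorem toLp_rep (hα : 1 < α) (f : Korobov α γ d) :
    ContinuousMap.toLp (E := ℂ) 2 volume ℂ (rep hα f) = toL2 f := by
  have h1 := (ContinuousMap.toLp (E := ℂ) 2 (volume : Measure (UnitAddTorus (Fin d))) ℂ).hasSum
    (hasSum_rep hα f)
  simp only [map_smul] at h1
  exact h1.unique (UnitAddTorus.hasSum_mFourier_series_L2 (toL2 f))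

theorem ae_eq_rep (hα : 1 < α) (f : Korobov α γ d) :
    (toL2 f : UnitAddTorus (Fin d) → ℂ) =ᵐ[volume] rep hα f := by
  have := ContinuousMap.coeFn_toLp (E := ℂ) (p := 2) (𝕜 := ℂ)
    (volume : Measure (UnitAddTorus (Fin d))) (rep hα f)
  rwa [toLp_rep] at this

/-- Continuous functions that agree almost everywhere on the torus agree everywhere, so the choice
made in `value` is immaterial. -/
theorem value_eq_rep (hα : 1 < α) (f : Korobov α γ d) (x : UnitAddTorus (Fin d)) :
    f.value x = rep hα f x := by
  have hex : ∃ g : C(UnitAddTorus (Fin d), ℂ),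
      (toL2 f : UnitAddTorus (Fin d) → ℂ) =ᵐ[volume] (g : UnitAddTorus (Fin d) → ℂ) :=
    ⟨_, ae_eq_rep hα f⟩
  rw [value, dif_pos hex]
  have h1 : (hex.choose : UnitAddTorus (Fin d) → ℂ) =ᵐ[volume] rep hα f :=
    hex.choose_spec.symm.trans (ae_eq_rep hα f)
  exact congrFun (Continuous.ae_eq_iff_eq volume (map_continuous hex.choose)
    (map_continuous (rep hα f)) |>.mp h1) x

theorem coeff_eq_integral_rep (hα : 1 < α) (f : Korobov α γ d) (h : Fin d → ℤ) :
    coeff (toL2 f) h = ∫ x, rep hα f x * UnitAddTorus.mFourier (-h) x := by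
  refine integral_congr_ae ((ae_eq_rep hα f).mono fun x hx => ?_)
  simp only [hx, smul_eq_mul, mul_comm]

theorem norm_toL2_sq_eq_integral (hα : 1 < α) (f : Korobov α γ d) :
    ‖toL2 f‖ ^ 2 = ∫ x, ‖rep hα f x‖ ^ 2 := by
  rw [(hasSum_sq_coeff (toL2 f)).unique (UnitAddTorus.hasSum_sq_mFourierCoeff (toL2 f))]
  exact integral_congr_ae ((ae_eq_rep hα f).mono fun x hx => by simp only [hx])

end Korobov

theorem lambdaStd_subset_lambdaAll {α : ℝ} (hα : 1 < α) (γ : Weights) (d : ℕ) :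
    LambdaStd α γ d ⊆ LambdaAll α γ d := by
  rintro L ⟨x, rfl⟩
  refine ⟨(ContinuousMap.evalCLM ℂ x).comp (Korobov.rep hα), funext fun f => ?_⟩
  rw [Korobov.value_eq_rep hα]
  rfl

/-! ### The error of the Monte Carlo algorithm -/

section Variance

variable {X : Type*} [MeasurableSpace X] {μ : Measure X} [IsProbabilityMeasure μ] {n : ℕ}

/-- The sample mean is unbiased, and independence makes its variance `Var(g)/n`, with `Var(g)` at
most the second moment. -/
theorem integral_sq_sampleMean_sub_le (hn : n ≠ 0) {g : X → ℝ} (hg : MemLp g 2 μ) :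
    ∫ ω : Fin n → X, (1 / (n : ℝ) * ∑ k, g (ω k) - ∫ x, g x ∂μ) ^ 2 ∂Measure.pi (fun _ => μ)
      ≤ (∫ x, g x ^ 2 ∂μ) / n := by
  have hn0 : (n : ℝ) ≠ 0 := by exact_mod_cast hn
  have hint : ∀ k : Fin n, Integrable (fun ω : Fin n → X => g (ω k)) (Measure.pi fun _ => μ) :=
    fun k => ((measurePreserving_eval (fun _ : Fin n => μ) k).integrable_comp
      hg.aestronglyMeasurable).mpr (hg.integrable one_le_two)
  have hmean : ∫ ω : Fin n → X, (1 / (n : ℝ) * ∑ k, g (ω k)) ∂Measure.pi (fun _ => μ)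
      = ∫ x, g x ∂μ := by
    rw [integral_const_mul, integral_finsetSum _ fun k _ => hint k]
    have : ∀ k : Fin n, ∫ ω : Fin n → X, g (ω k) ∂Measure.pi (fun _ => μ) = ∫ x, g x ∂μ :=
      fun k => by
        have h1 := (measurePreserving_eval (fun _ : Fin n => μ) k)
        have h2 := integral_map h1.measurable.aemeasurable (f := g)
          (by rw [h1.map_eq]; exact hg.aestronglyMeasurable)
        rw [h1.map_eq] at h2
        exact h2.symm
    simp [this, hn0]
  have hvar := ProbabilityTheory.variance_sum_pi (μ := fun _ : Fin n => μ) (X := fun _ => g)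
    fun _ => hg
  have hm : AEMeasurable (fun ω : Fin n → X => 1 / (n : ℝ) * ∑ k, g (ω k))
      (Measure.pi fun _ => μ) :=
    ((integrable_finsetSum _ fun k _ => hint k).const_mul _).aemeasurable
  have h1 := ProbabilityTheory.variance_eq_integral hm
  rw [hmean] at h1
  rw [← h1, ProbabilityTheory.variance_const_mul]
  have h2 : (fun ω : Fin n → X => ∑ k, g (ω k)) = ∑ k : Fin n, fun ω => g (ω k) := by
    ext ω; simp
  rw [h2, hvar, Finset.sum_const, Finset.card_univ, Fintype.card_fin, nsmul_eq_mul]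
  have h3 : ProbabilityTheory.variance g μ ≤ ∫ x, g x ^ 2 ∂μ :=
    ProbabilityTheory.variance_le_expectation_sq hg.aestronglyMeasurable
  calc _ = ProbabilityTheory.variance g μ / n := by field_simp
    _ ≤ _ := by gcongr

theorem integral_norm_sq_sampleMean_sub_le [TopologicalSpace X] [CompactSpace X] [BorelSpace X]
    [SecondCountableTopology X] (hn : n ≠ 0) {G : X → ℂ} (hG : Continuous G) :
    ∫ ω : Fin n → X, ‖1 / (n : ℂ) * ∑ k, G (ω k) - ∫ x, G x ∂μ‖ ^ 2 ∂Measure.pi (fun _ => μ)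
      ≤ (∫ x, ‖G x‖ ^ 2 ∂μ) / n := by
  have hcont : ∀ {Y : Type _} [TopologicalSpace Y] [CompactSpace Y] [MeasurableSpace Y]
      [OpensMeasurableSpace Y] (ν : Measure Y) [IsProbabilityMeasure ν] {F : Y → ℝ},
      Continuous F → Integrable F ν := fun ν _ F hF =>
    hF.integrable_of_hasCompactSupport (HasCompactSupport.of_compactSpace _)
  have hGi : Integrable G μ :=
    hG.integrable_of_hasCompactSupport (HasCompactSupport.of_compactSpace _)
  have hre : Continuous fun x => (G x).re := Complex.continuous_re.comp hG
  have him : Continuous fun x => (G x).im := Complex.continuous_im.comp hG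
  have hL2 : ∀ {g : X → ℝ}, Continuous g → MemLp g 2 μ := fun {g} hg =>
    (memLp_two_iff_integrable_sq hg.aestronglyMeasurable).mpr (hcont μ (hg.pow 2))
  have h1 := integral_sq_sampleMean_sub_le (μ := μ) hn (hL2 hre)
  have h2 := integral_sq_sampleMean_sub_le (μ := μ) hn (hL2 him)
  have hsplit : ∀ ω : Fin n → X, ‖1 / (n : ℂ) * ∑ k, G (ω k) - ∫ x, G x ∂μ‖ ^ 2
      = (1 / (n : ℝ) * ∑ k, (G (ω k)).re - ∫ x, (G x).re ∂μ) ^ 2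
        + (1 / (n : ℝ) * ∑ k, (G (ω k)).im - ∫ x, (G x).im ∂μ) ^ 2 := fun ω => by
    have e1 : ∫ x, (G x).re ∂μ = (∫ x, G x ∂μ).re := integral_re hGi
    have e2 : ∫ x, (G x).im ∂μ = (∫ x, G x ∂μ).im := integral_im hGi
    have e3 : (1 / (n : ℂ)) = ((1 / (n : ℝ) : ℝ) : ℂ) := by push_cast; rfl
    rw [Complex.sq_norm, Complex.normSq_apply, e1, e2, e3, Complex.sub_re, Complex.sub_im,
      Complex.re_ofReal_mul, Complex.im_ofReal_mul, Complex.re_sum, Complex.im_sum]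
    ring
  simp_rw [hsplit]
  rw [integral_add]
  · have h3 : ∫ x, ‖G x‖ ^ 2 ∂μ = ∫ x, (G x).re ^ 2 ∂μ + ∫ x, (G x).im ^ 2 ∂μ := by
      rw [← integral_add (hcont μ (F := fun x => (G x).re ^ 2) (hre.pow 2))
        (hcont μ (F := fun x => (G x).im ^ 2) (him.pow 2))]
      refine integral_congr_ae (Filter.Eventually.of_forall fun x => ?_)
      simp only [Complex.sq_norm, Complex.normSq_apply]
      ring
    rw [h3, add_div]
    exact add_le_add h1 h2
  · exact hcont _ (by fun_prop)
  · exact hcont _ (by fun_prop)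

end Variance

/-! ### Mean square error and sample count of the Monte Carlo algorithm. -/

section MonteCarloError

open Korobov

variable {α : ℝ} {γ : Weights} {d : ℕ}

theorem mcCoeff_eq_rep (hα : 1 < α) {n : ℕ} (f : Korobov α γ d)
    (ω : Fin n → UnitAddTorus (Fin d)) (h : Fin d → ℤ) :
    mcCoeff f ω h = 1 / (n : ℂ) * ∑ k, rep hα f (ω k) * UnitAddTorus.mFourier (-h) (ω k) := by
  simp only [mcCoeff, value_eq_rep hα]

theorem continuous_mcCoeff (hα : 1 < α) {n : ℕ} (h : Fin d → ℤ) :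
    Continuous fun q : Korobov α γ d × (Fin n → UnitAddTorus (Fin d)) => mcCoeff q.1 q.2 h := by
  simp only [mcCoeff_eq_rep hα]
  refine continuous_const.mul (continuous_finsetSum _ fun k _ => ?_)
  have h1 : Continuous fun q : Korobov α γ d × (Fin n → UnitAddTorus (Fin d)) => q.2 k :=
    (continuous_apply k).comp continuous_snd
  exact (((rep hα).continuous.comp continuous_fst).eval h1).mul
    ((map_continuous (UnitAddTorus.mFourier (-h))).comp h1)

theorem continuous_mcCoeff_right (hα : 1 < α) {n : ℕ} (f : Korobov α γ d) (h : Fin d → ℤ) :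
    Continuous fun ω : Fin n → UnitAddTorus (Fin d) => mcCoeff f ω h :=
  (continuous_mcCoeff hα h).comp
    (g := fun q : Korobov α γ d × (Fin n → UnitAddTorus (Fin d)) => mcCoeff q.1 q.2 h)
    (f := fun ω => (f, ω)) (Continuous.prodMk_right f)

/-- The estimator is a sample mean of `f(x) exp(-2πi h·x)`, whose mean is `f̂(h)` and whose modulus
is `|f(x)|`. -/
theorem integral_norm_coeff_sub_mcCoeff_sq_le (hα : 1 < α) {n : ℕ} (hn : n ≠ 0)
    (f : Korobov α γ d) (h : Fin d → ℤ) :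
    ∫ ω : Fin n → UnitAddTorus (Fin d), ‖coeff f.toL2 h - mcCoeff f ω h‖ ^ 2
      ≤ ‖f.toL2‖ ^ 2 / n := by
  have hG : Continuous fun x => rep hα f x * UnitAddTorus.mFourier (-h) x :=
    (map_continuous _).mul (map_continuous _)
  have h1 := integral_norm_sq_sampleMean_sub_le (μ := (volume : Measure (UnitAddTorus (Fin d))))
    hn hG
  have h2 : ∀ x, ‖rep hα f x * UnitAddTorus.mFourier (-h) x‖ = ‖rep hα f x‖ := fun x => by
    have : ‖UnitAddTorus.mFourier (-h) x‖ = 1 := by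
      rw [UnitAddTorus.mFourier, ContinuousMap.coe_mk, norm_prod]
      exact Finset.prod_eq_one fun j _ => Circle.norm_coe _
    rw [norm_mul, this, mul_one]
  simp_rw [h2, ← norm_toL2_sq_eq_integral, ← coeff_eq_integral_rep, ← mcCoeff_eq_rep hα] at h1
  simp_rw [norm_sub_rev (coeff f.toL2 h)]
  exact h1

theorem mcAlgorithm_eq_sum {ε : ℝ} (hfin : (indexSet α γ (ε / Real.sqrt 2) d).Finite)
    (f : Korobov α γ d) (ω : Fin (mcSamples α γ ε d) → UnitAddTorus (Fin d)) :
    mcAlgorithm ε f ω = ∑ h ∈ hfin.toFinset, mcCoeff f ω h • UnitAddTorus.mFourierLp 2 h :=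
  finsum_mem_eq_finite_toFinset_sum _ hfin

theorem isRandomizedAlgorithm_mc (hα : 1 < α) {ε : ℝ} (hε : 0 < ε) :
    IsRandomizedAlgorithm (LambdaStd α γ d) (mcSamples α γ ε d) volume
      (mcAlgorithm (α := α) (γ := γ) (d := d) ε) := by
  have hfin : (indexSet α γ (ε / Real.sqrt 2) d).Finite :=
    finite_indexSet (one_pos.trans hα) (by positivity)
  -- The map `φ_ω` may use the sample points themselves, which enter through the exponentials.
  -- Measurability of the error follows from its joint continuity in `(f, ω)`.
  refine ⟨inferInstance, ⟨fun k ω f => f.value (ω k), fun ω v =>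
    ∑ᶠ h ∈ indexSet α γ (ε / Real.sqrt 2) d, ((1 / (mcSamples α γ ε d : ℂ)) *
      ∑ k, v k * UnitAddTorus.mFourier (-h) (ω k)) • UnitAddTorus.mFourierLp 2 h,
    fun k ω => ⟨ω k, rfl⟩, fun f ω => rfl⟩, ?_⟩
  simp only [mcAlgorithm_eq_sum hfin]
  refine Continuous.measurable (Continuous.norm (Continuous.sub ?_ ?_))
  · exact (continuous_toL2 (zero_le_one.trans hα.le)).comp continuous_fst
  · exact continuous_finsetSum _ fun h _ => (continuous_mcCoeff hα h).smul continuous_const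

theorem ncard_indexSet_pos (hα : 0 < α) {ε : ℝ} (hε0 : 0 < ε) (hε1 : ε < 1) :
    0 < (indexSet α γ ε d).ncard := by
  rw [Set.ncard_pos (finite_indexSet hα hε0)]
  refine ⟨0, ?_⟩
  change (rWeight α γ (0 : Fin d → ℤ))⁻¹ > ε ^ 2
  rw [rWeight_zero, inv_one]
  exact pow_lt_one₀ hε0.le hε1 two_ne_zero

theorem div_sqrt_two_lt_one {ε : ℝ} (hε1 : ε < 1) : ε / Real.sqrt 2 < 1 := by
  rw [div_lt_one (by positivity)]
  exact hε1.trans (Real.one_lt_sqrt_two)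

theorem mcSamples_pos (hα : 0 < α) {ε : ℝ} (hε0 : 0 < ε) (hε1 : ε < 1) :
    0 < mcSamples α γ ε d := by
  have h1 := ncard_indexSet_pos (γ := γ) (d := d) hα (ε := ε / Real.sqrt 2) (by positivity)
    (div_sqrt_two_lt_one hε1)
  have h2 : (0 : ℝ) < (indexSet α γ (ε / Real.sqrt 2) d).ncard := by exact_mod_cast h1
  exact Nat.ceil_pos.mpr (by positivity)

theorem ranError_mc_le (hα : 1 < α) {ε : ℝ} (hε0 : 0 < ε) (hε1 : ε < 1) :
    ranError volume (mcAlgorithm (α := α) (γ := γ) (d := d) ε) ≤ ENNReal.ofReal ε := by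
  have hα0 : 0 < α := one_pos.trans hα
  have hfin : (indexSet α γ (ε / Real.sqrt 2) d).Finite := finite_indexSet hα0 (by positivity)
  have hn := mcSamples_pos (γ := γ) (d := d) hα0 hε0 hε1
  have hn0 : (0 : ℝ) < mcSamples α γ ε d := by exact_mod_cast hn
  have hsq : (ε / Real.sqrt 2) ^ 2 = ε ^ 2 / 2 := by rw [div_pow, Real.sq_sqrt zero_le_two]
  refine ranError_le hε0.le fun f hf => ?_
  have hf2 : ‖f‖ ^ 2 ≤ 1 := pow_le_one₀ (norm_nonneg _) hf
  set S := hfin.toFinset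
  have hint : ∀ h, Integrable fun ω : Fin (mcSamples α γ ε d) → UnitAddTorus (Fin d) =>
      ‖coeff f.toL2 h - mcCoeff f ω h‖ ^ 2 := fun h => by
    refine Continuous.integrable_of_hasCompactSupport ?_ (HasCompactSupport.of_compactSpace _)
    exact (continuous_const.sub (continuous_mcCoeff_right hα f h)).norm.pow 2
  have hpt : ∀ ω, ‖f.toL2 - mcAlgorithm ε f ω‖ ^ 2
      ≤ ∑ h ∈ S, ‖coeff f.toL2 h - mcCoeff f ω h‖ ^ 2 + ε ^ 2 / 2 := fun ω => by
    rw [mcAlgorithm_eq_sum hfin]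
    refine (norm_sub_sum_sq_le f S _ (τ := ε ^ 2 / 2) (by positivity) fun h hh => ?_).trans ?_
    · have h1 : ¬ (rWeight α γ h)⁻¹ > (ε / Real.sqrt 2) ^ 2 := by simpa [S, indexSet] using hh
      rw [hsq] at h1
      exact not_lt.mp h1
    · gcongr
      exact mul_le_of_le_one_right (by positivity) hf2
  have hsum : Integrable fun ω : Fin (mcSamples α γ ε d) → UnitAddTorus (Fin d) =>
      ∑ h ∈ S, ‖coeff f.toL2 h - mcCoeff f ω h‖ ^ 2 + ε ^ 2 / 2 :=
    (integrable_finsetSum _ fun h _ => hint h).add (integrable_const _)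
  refine (lintegral_mono fun ω => ENNReal.ofReal_le_ofReal (hpt ω)).trans ?_
  rw [← ofReal_integral_eq_lintegral_ofReal hsum
    (Filter.Eventually.of_forall fun ω => by positivity)]
  refine ENNReal.ofReal_le_ofReal ?_
  rw [integral_add (integrable_finsetSum _ fun h _ => hint h) (integrable_const _),
    integral_finsetSum _ fun h _ => hint h, integral_const, probReal_univ, one_smul]
  have h1 : ∑ h ∈ S, ∫ ω : Fin (mcSamples α γ ε d) → UnitAddTorus (Fin d),
      ‖coeff f.toL2 h - mcCoeff f ω h‖ ^ 2 ≤ ∑ _h ∈ S, 1 / (mcSamples α γ ε d : ℝ) := by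
    refine Finset.sum_le_sum fun h _ =>
      (integral_norm_coeff_sub_mcCoeff_sq_le hα hn.ne' f h).trans ?_
    gcongr
    exact (pow_le_pow_left₀ (norm_nonneg _) (norm_toL2_le hα0.le f) 2).trans hf2
  -- The choice `n ≥ 2|R|/ε²` makes the total variance at most `ε²/2`, the same as the tail.
  have h2 : (S.card : ℝ) * (1 / (mcSamples α γ ε d : ℝ)) ≤ ε ^ 2 / 2 := by
    rw [mul_one_div, div_le_iff₀ hn0]
    have h3 : 2 * ((indexSet α γ (ε / Real.sqrt 2) d).ncard : ℝ) / ε ^ 2 ≤ mcSamples α γ ε d :=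
      Nat.le_ceil _
    rw [Set.ncard_eq_toFinset_card _ hfin, div_le_iff₀ (by positivity)] at h3
    linarith
  rw [Finset.sum_const, nsmul_eq_mul] at h1
  linarith

/-- Bounds on the number of frequencies and on the number of samples. -/
theorem exists_mcSamples_le (hα : 0 < α) (h : sumExponent γ < ⊤) {p : ℝ}
    (hp : 2 * max (sumExponent γ).toReal α⁻¹ < p) :
    ∃ K : ℝ, 0 < K ∧ ∀ (d : ℕ) (ε : ℝ), 0 < ε → ε < 1 →
      ((indexSet α γ (ε / Real.sqrt 2) d).ncard : ℝ) ≤ K * (1 / ε) ^ p ∧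
      (mcSamples α γ ε d : ℝ) ≤ K * (1 / ε) ^ (p + 2) := by
  obtain ⟨C, hC, hcard⟩ := exists_ncard_indexSet_le hα h (s := p / 2) (by linarith)
  rw [mul_div_cancel₀ _ two_ne_zero] at hcard
  have hp0 : 0 ≤ p := (max_sumExponent_nonneg hα).trans hp.le
  set B := C * Real.sqrt 2 ^ p with hB
  have hB0 : 0 < B := by positivity
  -- The summand `1` absorbs the rounding up in the sample count, as `(1/ε)^(p+2) ≥ 1`.
  refine ⟨2 * B + 1, by positivity, fun d ε hε0 hε1 => ?_⟩
  have h1 : ((indexSet α γ (ε / Real.sqrt 2) d).ncard : ℝ) ≤ B * (1 / ε) ^ p := by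
    refine (hcard d (ε / Real.sqrt 2) (by positivity)).trans (le_of_eq ?_)
    rw [Real.rpow_neg (by positivity), ← Real.inv_rpow (by positivity), inv_div,
      Real.div_rpow (by positivity) hε0.le, hB, Real.div_rpow zero_le_one hε0.le, Real.one_rpow]
    ring
  have hpow : (0 : ℝ) < (1 / ε) ^ p := by positivity
  refine ⟨h1.trans ?_, ?_⟩
  · gcongr
    linarith
  · have h2 : (1 : ℝ) ≤ (1 / ε) ^ (p + 2) :=
      Real.one_le_rpow (by rw [le_div_iff₀ hε0]; linarith) (by linarith)
    have h3 : (1 / ε) ^ (p + 2) = (1 / ε) ^ p / ε ^ 2 := by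
      rw [Real.rpow_add (by positivity), Real.rpow_two, one_div_pow, mul_one_div]
    calc (mcSamples α γ ε d : ℝ)
        ≤ 2 * ((indexSet α γ (ε / Real.sqrt 2) d).ncard : ℝ) / ε ^ 2 + 1 :=
          (Nat.ceil_lt_add_one (by positivity)).le
      _ ≤ 2 * (B * (1 / ε) ^ p) / ε ^ 2 + (1 / ε) ^ (p + 2) := by gcongr
      _ = _ := by rw [h3]; ring

end MonteCarloError

/-! ### Tractability in the class of function values -/

section Standard

variable {α : ℝ} {γ : Weights}

theorem exists_compBound_std (hα : 1 < α) (h : sumExponent γ < ⊤) {p : ℝ}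
    (hp : 2 * max (sumExponent γ).toReal α⁻¹ < p) :
    ∃ C : ℝ, 0 ≤ C ∧ CompBound (LambdaStd α γ) C (p + 2) 0 := by
  obtain ⟨K, hK, hb⟩ := exists_mcSamples_le (one_pos.trans hα) h hp
  refine ⟨K, hK.le, fun ε hε0 hε1 d hd => ?_⟩
  have h1 : (compRan ε (LambdaStd α γ d) : ℝ≥0∞) ≤ (mcSamples α γ ε d : ℝ≥0∞) := by
    exact_mod_cast compRan_le (isRandomizedAlgorithm_mc hα hε0) (ranError_mc_le hα hε0 hε1)
  refine h1.trans ?_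
  rw [← ENNReal.ofReal_natCast, Real.rpow_zero, mul_one]
  refine ENNReal.ofReal_le_ofReal ((hb d ε hε0 hε1).2.trans (le_of_eq ?_))
  rw [one_div, Real.inv_rpow hε0.le, Real.rpow_neg hε0.le]

theorem stronglyTractable_std (hα : 1 < α) (h : sumExponent γ < ⊤) :
    StronglyTractable (LambdaStd α γ) := by
  obtain ⟨C, hC, hb⟩ := exists_compBound_std hα h (lt_add_one _)
  exact ⟨C, _, hC, by linarith [max_sumExponent_nonneg (γ := γ) (one_pos.trans hα)], hb⟩

theorem strongExponent_std_mem (hα : 1 < α) (h : sumExponent γ < ⊤) :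
    strongExponent (LambdaStd α γ) ∈
      Set.Icc (strongExponent (LambdaAll α γ)) (strongExponent (LambdaAll α γ) + 2) := by
  have hα0 : 0 < α := one_pos.trans hα
  have h0 := max_sumExponent_nonneg (γ := γ) hα0
  rw [strongExponent_all hα0 h]
  have hlb : 2 * max (sumExponent γ).toReal α⁻¹ ∈ lowerBounds
      {p : ℝ | 0 ≤ p ∧ ∃ C : ℝ, 0 ≤ C ∧ CompBound (LambdaStd α γ) C p 0} := by
    rintro p ⟨-, C, hC, hb⟩
    exact hb.two_mul_max_le hα0 (lambdaStd_subset_lambdaAll hα γ) hC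
  constructor
  · obtain ⟨C, p, hC, hp, hb⟩ := stronglyTractable_std hα h
    exact le_csInf ⟨p, hp, C, hC, hb⟩ hlb
  · refine le_of_forall_gt_imp_ge_of_dense fun p hp => ?_
    obtain ⟨C, hC, hb⟩ := exists_compBound_std hα h (p := p - 2) (by linarith)
    rw [sub_add_cancel] at hb
    exact csInf_le ⟨_, hlb⟩ ⟨by linarith, C, hC, hb⟩

end Standard

/-! ### Straight-line programs -/

section Programs

variable {ι : Type} {d : ℕ} {P P' : List (Instr ι d)}
  {u v : ((Fin d → ℝ) → ℂ) → (ι → ℂ) → ℂ}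

theorem runProgram_append_singleton (F : (Fin d → ℝ) → ℂ) (x : ι → ℂ) (P : List (Instr ι d))
    (I : Instr ι d) :
    runProgram F x (P ++ [I]) = runProgram F x P ++ [I.eval F x (runProgram F x P)] := by
  simp [runProgram]

theorem runProgram_prefix (F : (Fin d → ℝ) → ℂ) (x : ι → ℂ) (P Q : List (Instr ι d)) :
    runProgram F x P <+: runProgram F x (P ++ Q) := by
  induction Q using List.reverseRecOn with
  | nil => simp
  | append_singleton Q I ih =>
    rw [← List.append_assoc, runProgram_append_singleton]
    exact ih.trans (List.prefix_append _ _)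

theorem length_runProgram (F : (Fin d → ℝ) → ℂ) (x : ι → ℂ) (P : List (Instr ι d)) :
    (runProgram F x P).length = P.length := by
  induction P using List.reverseRecOn with
  | nil => rfl
  | append_singleton Q I ih => simp [runProgram_append_singleton, ih]

/-- After the execution of `P`, and also of every extension of `P`, the operand `o` has the
value `v`. -/
def Provides (P : List (Instr ι d)) (o : Operand ι)
    (v : ((Fin d → ℝ) → ℂ) → (ι → ℂ) → ℂ) : Prop :=
  ∀ Q F x, o.get x (runProgram F x (P ++ Q)) = v F x

theorem Provides.mono {o : Operand ι} (h : Provides P o v) (hP : P <+: P') : Provides P' o v := by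
  obtain ⟨R, rfl⟩ := hP
  intro Q F x
  rw [List.append_assoc]
  exact h _ F x

theorem Provides.get_eq {o : Operand ι} (h : Provides P o v) (F : (Fin d → ℝ) → ℂ) (x : ι → ℂ) :
    o.get x (runProgram F x P) = v F x := by
  simpa using h [] F x

theorem provides_input (P : List (Instr ι d)) (i : ι) :
    Provides P (.input i) fun _ x => x i := fun _ _ _ => rfl

/-- Registers are numbered from zero and never overwritten, so the result of the next instruction
sits at index `P.length` and survives every extension. -/
theorem provides_append_singleton {I : Instr ι d}
    (h : ∀ F x, I.eval F x (runProgram F x P) = v F x) :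
    Provides (P ++ [I]) (.reg P.length) v := by
  intro Q F x
  obtain ⟨R, hR⟩ := runProgram_prefix F x (P ++ [I]) Q
  rw [Operand.get, ← hR, runProgram_append_singleton, h, ← length_runProgram F x P]
  simp

theorem programCost_append (c : ℝ) (P Q : List (Instr ι d)) :
    programCost c (P ++ Q) = programCost c P + programCost c Q := by
  simp [programCost]

/-- After the execution of `P`, the value `v` can be computed with at most `a` evaluations and at
most `b` other instructions. -/
def ComputesWithin (P : List (Instr ι d)) (v : ((Fin d → ℝ) → ℂ) → (ι → ℂ) → ℂ)
    (a b : ℕ) : Prop :=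
  ∃ (Q : List (Instr ι d)) (k : ℕ), (∀ c, 0 ≤ c → programCost c Q ≤ a * c + b) ∧
    Provides (P ++ Q) (.reg k) v

theorem ComputesWithin.then_instr {a b : ℕ} (h : ComputesWithin P u a b)
    (I : ℕ → Instr ι d) (hI : ∀ k c, (I k).cost c = 1)
    (hv : ∀ P' k, P <+: P' → Provides P' (.reg k) u →
      ∀ F x, (I k).eval F x (runProgram F x P') = v F x) :
    ComputesWithin P v a (b + 1) := by
  obtain ⟨Q, k, hQ, hk⟩ := h
  refine ⟨Q ++ [I k], (P ++ Q).length, fun c hc => ?_, ?_⟩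
  · have h1 := hQ c hc
    have h2 : programCost c [I k] = 1 := by simp [programCost, hI]
    rw [programCost_append, h2]
    push_cast
    linarith
  · rw [← List.append_assoc]
    exact provides_append_singleton (hv _ k (List.prefix_append _ _) hk)

theorem computesWithin_const (P : List (Instr ι d)) (z : ℂ) :
    ComputesWithin P (fun _ _ => z) 0 1 :=
  ⟨[.const z], P.length, fun c _ => by simp [programCost, Instr.cost],
    provides_append_singleton fun _ _ => rfl⟩

theorem computesWithin_query (P : List (Instr ι d)) (p : Fin d → ι) :
    ComputesWithin P (fun F x => F fun j => (x (p j)).re) 1 0 :=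
  ⟨[.query fun j => .input (p j)], P.length, fun c _ => by simp [programCost, Instr.cost],
    provides_append_singleton fun _ _ => rfl⟩

theorem ComputesWithin.exp {a b : ℕ} (h : ComputesWithin P u a b) :
    ComputesWithin P (fun F x => Complex.exp (u F x)) a (b + 1) :=
  h.then_instr (fun k => .exp (.reg k)) (fun _ _ => rfl) fun P' k _ hk F x => by
    rw [Instr.eval, hk.get_eq]

theorem ComputesWithin.mul_operand {a b : ℕ} (h : ComputesWithin P u a b) {o : Operand ι}
    (ho : Provides P o v) : ComputesWithin P (fun F x => u F x * v F x) a (b + 1) :=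
  h.then_instr (fun k => .mul (.reg k) o) (fun _ _ => rfl) fun P' k hP hk F x => by
    rw [Instr.eval, hk.get_eq, (ho.mono hP).get_eq]

theorem ComputesWithin.add_operand {a b : ℕ} (h : ComputesWithin P u a b) {o : Operand ι}
    (ho : Provides P o v) : ComputesWithin P (fun F x => u F x + v F x) a (b + 1) :=
  h.then_instr (fun k => .add (.reg k) o) (fun _ _ => rfl) fun P' k hP hk F x => by
    rw [Instr.eval, hk.get_eq, (ho.mono hP).get_eq]

/-- If `w` can be computed once `v` is available, then it can be computed. -/
theorem ComputesWithin.bind {w : ((Fin d → ℝ) → ℂ) → (ι → ℂ) → ℂ} {a b a' b' : ℕ}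
    (h : ComputesWithin P v a b)
    (hw : ∀ P' k, P <+: P' → Provides P' (.reg k) v → ComputesWithin P' w a' b') :
    ComputesWithin P w (a + a') (b + b') := by
  obtain ⟨Q, k, hQ, hk⟩ := h
  obtain ⟨Q', k', hQ', hk'⟩ := hw _ k (List.prefix_append P Q) hk
  refine ⟨Q ++ Q', k', fun c hc => ?_, by rwa [← List.append_assoc]⟩
  have h1 := hQ c hc
  have h2 := hQ' c hc
  rw [programCost_append]
  push_cast
  linarith

/-- Each term costs one extra addition; the final `+ 1` is the constant `0` from which the
accumulation starts. -/
theorem computesWithin_sum {κ : Type*} {t : κ → ((Fin d → ℝ) → ℂ) → (ι → ℂ) → ℂ} {a b : ℕ}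
    (h : ∀ i P', P <+: P' → ComputesWithin P' (t i) a b) (S : Finset κ) :
    ComputesWithin P (fun F x => ∑ i ∈ S, t i F x) (S.card * a) (S.card * (b + 1) + 1) := by
  classical
  induction S using Finset.induction_on with
  | empty => simpa using computesWithin_const P 0
  | insert i S hi ih =>
    have h1 := ih.bind fun P' k hP hk => (h i P' hP).add_operand hk
    simp only [Finset.sum_insert hi, Finset.card_insert_of_notMem hi]
    convert h1 using 1 <;> ring

/-- All values remain in registers of their own, so that later parts of a program can share them
without recomputation. -/
theorem exists_program_forall {κ : Type*} {t : κ → ((Fin d → ℝ) → ℂ) → (ι → ℂ) → ℂ} {a b : ℕ}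
    (h : ∀ i P', P <+: P' → ComputesWithin P' (t i) a b) (S : Finset κ) :
    ∃ (Q : List (Instr ι d)) (out : κ → ℕ),
      (∀ c, 0 ≤ c → programCost c Q ≤ (S.card * a : ℕ) * c + (S.card * b : ℕ)) ∧
      ∀ i ∈ S, Provides (P ++ Q) (.reg (out i)) (t i) := by
  classical
  induction S using Finset.induction_on with
  | empty => exact ⟨[], fun _ => 0, by simp [programCost], by simp⟩
  | insert i S hi ih =>
    obtain ⟨Q, out, hQ, hout⟩ := ih
    obtain ⟨Q', k, hQ', hk⟩ := h i (P ++ Q) (List.prefix_append _ _)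
    rw [List.append_assoc] at hk
    refine ⟨Q ++ Q', Function.update out i k, fun c hc => ?_, fun j hj => ?_⟩
    · have h1 := hQ c hc
      have h2 := hQ' c hc
      rw [programCost_append, Finset.card_insert_of_notMem hi]
      push_cast at h1 ⊢
      linarith
    · rcases eq_or_ne j i with rfl | hji
      · rwa [Function.update_self]
      · rw [Function.update_of_ne hji, ← List.append_assoc]
        exact (hout j (Finset.mem_of_mem_insert_of_ne hj hji)).mono (List.prefix_append _ _)

/-- The exponential of a linear form in the inputs. -/
theorem computesWithin_exp_linear (P : List (Instr ι d)) (z : Fin d → ℂ) (p : Fin d → ι) :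
    ComputesWithin P (fun _ x => Complex.exp (∑ j, z j * x (p j))) 0 (3 * d + 2) := by
  -- Each coordinate takes a constant, a product and an addition; the initial zero and the
  -- exponential account for the `2` in `3d + 2`.
  have h1 := (computesWithin_sum (P := P) (t := fun j _ x => z j * x (p j)) (a := 0) (b := 2)
    (fun j P' _ => (computesWithin_const P' (z j)).mul_operand (provides_input P' (p j)))
    Finset.univ).exp
  simp only [Finset.card_univ, Fintype.card_fin, mul_zero] at h1
  convert h1 using 1
  ring

end Programs

/-! ### Implementation of the Monte Carlo algorithm -/

section Implementation

variable {α : ℝ} {γ : Weights} {d : ℕ}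

theorem mFourier_toTorus (h : Fin d → ℤ) (x : Fin d → ℝ) :
    UnitAddTorus.mFourier h (toTorus x)
      = Complex.exp (∑ j, 2 * Real.pi * Complex.I * h j * (x j : ℂ)) := by
  rw [Complex.exp_sum, UnitAddTorus.mFourier, ContinuousMap.coe_mk]
  refine Finset.prod_congr rfl fun j _ => ?_
  rw [toTorus, fourier_coe_apply]
  simp

theorem exists_implementsMC {ε : ℝ} (hfin : (indexSet α γ (ε / Real.sqrt 2) d).Finite)
    (hd : 1 ≤ d) (hR : 0 < (indexSet α γ (ε / Real.sqrt 2) d).ncard)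
    (hn : 0 < mcSamples α γ ε d) :
    ∃ P : List (Instr ((Fin (mcSamples α γ ε d) × Fin d) ⊕ Fin d) d),
      ImplementsMC α γ ε d P ∧ ∀ c : ℝ, 0 ≤ c → programCost c P ≤ mcSamples α γ ε d * c +
        18 * ((indexSet α γ (ε / Real.sqrt 2) d).ncard * mcSamples α γ ε d * d) := by
  set n := mcSamples α γ ε d
  set S := hfin.toFinset
  let ι := (Fin n × Fin d) ⊕ Fin d
  -- All samples of `f` are taken here, once each, so the number of evaluations is `n` and not `|R|
  -- n`.
  obtain ⟨Q₁, q, hQ₁, hq⟩ := exists_program_forall (P := ([] : List (Instr ι d)))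
    (t := fun k F x => F fun j => (x (.inl (k, j))).re) (a := 1) (b := 0)
    (fun k P' _ => computesWithin_query P' fun j => .inl (k, j)) Finset.univ
  rw [List.nil_append] at hq
  -- Per frequency: `n` terms, each with an exponential (`3d + 2`), a product and an addition, then
  -- one instruction each for the initial zero, the constant `1/n` and the final product.
  obtain ⟨Q₂, out, hQ₂, hout⟩ := exists_program_forall (P := Q₁)
    (t := fun (h : Fin d → ℤ) F (x : ι → ℂ) => (∑ k, Complex.exp
      (∑ j, 2 * Real.pi * Complex.I * ((-h) j : ℤ) * x (.inl (k, j))) *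
        F fun j => (x (.inl (k, j))).re) * (1 / (n : ℂ)))
    (a := 0) (b := (n * (3 * d + 4) + 1) + 2)
    (fun h P' hP => by
      have h1 := (computesWithin_const P' (1 / (n : ℂ))).bind (w := fun F (x : ι → ℂ) =>
        (∑ k, Complex.exp (∑ j, 2 * Real.pi * Complex.I * ((-h) j : ℤ) * x (.inl (k, j))) *
          F fun j => (x (.inl (k, j))).re) * (1 / (n : ℂ))) (a' := 0)
        (b' := (n * (3 * d + 4) + 1) + 1) fun P'' r hP' hr => by
          refine ComputesWithin.mul_operand ?_ hr
          have h2 := computesWithin_sum (P := P'') (t := fun (k : Fin n) F (x : ι → ℂ) =>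
            Complex.exp (∑ j, 2 * Real.pi * Complex.I * ((-h) j : ℤ) * x (.inl (k, j))) *
              F fun j => (x (.inl (k, j))).re) (a := 0) (b := 3 * d + 2 + 1)
            (fun k P₃ hP₃ => (computesWithin_exp_linear P₃ _ fun j => .inl (k, j)).mul_operand
              ((hq k (Finset.mem_univ k)).mono (hP.trans (hP'.trans hP₃)))) Finset.univ
          simpa using h2
      convert h1 using 1
      ring) S
  obtain ⟨Q₃, res, hQ₃, hres⟩ := computesWithin_sum (P := Q₁ ++ Q₂)
    (t := fun (h : S) F (x : ι → ℂ) => Complex.exp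
      (∑ j, 2 * Real.pi * Complex.I * ((h : Fin d → ℤ) j : ℤ) * x (.inr j)) *
      ((∑ k, Complex.exp
      (∑ j, 2 * Real.pi * Complex.I * ((-(h : Fin d → ℤ)) j : ℤ) * x (.inl (k, j))) *
        F fun j => (x (.inl (k, j))).re) * (1 / (n : ℂ)))) (a := 0) (b := 3 * d + 2 + 1)
    (fun h P' hP => (computesWithin_exp_linear P' _ fun j => .inr j).mul_operand
      ((hout h h.2).mono hP)) Finset.univ
  have hy : ∀ (f : Korobov α γ d) (ω : Fin n → Fin d → ℝ) (h : Fin d → ℤ),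
      (∑ k, Complex.exp (∑ j, 2 * Real.pi * Complex.I * ((-h) j : ℤ) * (ω k j : ℂ)) *
        f.value (toTorus (ω k))) * (1 / (n : ℂ)) = mcCoeff f (fun k => toTorus (ω k)) h :=
    fun f ω h => by
      rw [mcCoeff, mul_comm]
      congr 1
      refine Finset.sum_congr rfl fun k _ => ?_
      rw [mFourier_toTorus, mul_comm]
  refine ⟨Q₁ ++ Q₂ ++ Q₃, ⟨out, res, fun f ω x => ⟨fun h hh => ?_, ?_⟩⟩, fun c hc => ?_⟩
  · have h1 := ((hout h (hfin.mem_toFinset.mpr hh)).mono (List.prefix_append _ Q₃)).get_eq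
      (fun t => f.value (toTorus t))
      (Sum.elim (fun q => ((ω q.1 q.2 : ℝ) : ℂ)) fun j => ((x j : ℝ) : ℂ))
    refine h1.trans ?_
    simp only [Sum.elim_inl, Complex.ofReal_re]
    exact hy f ω h
  · have h1 := hres.get_eq (fun t => f.value (toTorus t))
      (Sum.elim (fun q => ((ω q.1 q.2 : ℝ) : ℂ)) fun j => ((x j : ℝ) : ℂ))
    refine h1.trans ?_
    rw [finsum_mem_eq_finite_toFinset_sum _ hfin, ← Finset.sum_coe_sort hfin.toFinset]
    refine Finset.sum_congr rfl fun h _ => ?_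
    simp only [Sum.elim_inl, Sum.elim_inr, Complex.ofReal_re]
    rw [mFourier_toTorus, mul_comm, ← hy f ω h]
  · have h1 := hQ₁ c hc
    have h2 := hQ₂ c hc
    have h3 := hQ₃ c hc
    have hcard : (indexSet α γ (ε / Real.sqrt 2) d).ncard = S.card :=
      Set.ncard_eq_toFinset_card _ hfin
    rw [hcard] at hR ⊢
    rw [programCost_append, programCost_append]
    simp only [Finset.card_univ, Fintype.card_fin, Fintype.card_coe, mul_one, mul_zero,
      Nat.cast_zero, zero_mul, add_zero, zero_add] at h1 h2 h3
    -- Since `|R|`, `n` and `d` are at least `1`, every monomial is at most `|R| n d`, and the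
    -- coefficients add up to `3 + 4 + 3 + 3 + 4 + 1 = 18`.
    have h4 : S.card * (n * (3 * d + 4) + 1 + 2) + (S.card * (3 * d + 2 + 1 + 1) + 1)
        ≤ 18 * (S.card * n * d) := by
      have e1 : S.card * n * 1 ≤ S.card * n * d := Nat.mul_le_mul_left _ hd
      have e2 : S.card * 1 * d ≤ S.card * n * d :=
        Nat.mul_le_mul_right _ (Nat.mul_le_mul_left _ hn)
      have e3 : S.card * 1 ≤ S.card * n := Nat.mul_le_mul_left _ hn
      nlinarith
    have h5 : ((S.card * (n * (3 * d + 4) + 1 + 2) + (S.card * (3 * d + 2 + 1 + 1) + 1) : ℕ) : ℝ)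
        ≤ 18 * (S.card * n * d) := by exact_mod_cast h4
    rw [Nat.cast_add] at h5
    linarith

theorem exists_implementsMC_cost_le (hα : 0 < α) (h : sumExponent γ < ⊤) {p : ℝ}
    (hp : 2 * max (sumExponent γ).toReal α⁻¹ < p) :
    ∃ K : ℝ, 0 < K ∧ ∀ d : ℕ, 1 ≤ d → ∀ ε : ℝ, 0 < ε → ε < 1 →
      (mcSamples α γ ε d : ℝ) ≤ K * (1 / ε) ^ (p + 2) ∧
      ∃ P : List (Instr ((Fin (mcSamples α γ ε d) × Fin d) ⊕ Fin d) d),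
        ImplementsMC α γ ε d P ∧ ∀ c : ℝ, 0 ≤ c → programCost c P ≤
          K * ((1 / ε) ^ (p + 2) * c + (1 / ε) ^ (2 * p + 2) * (d : ℝ)) := by
  obtain ⟨K, hK, hb⟩ := exists_mcSamples_le hα h hp
  -- The first entry bounds the evaluations, the second the remaining `18 |R| n d` instructions,
  -- where `|R|` and `n` each contribute a factor `K`.
  refine ⟨max K (18 * (K * K)), lt_max_of_lt_left hK, fun d hd ε hε0 hε1 => ?_⟩
  obtain ⟨hR, hn⟩ := hb d ε hε0 hε1
  have hfin : (indexSet α γ (ε / Real.sqrt 2) d).Finite := finite_indexSet hα (by positivity)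
  obtain ⟨P, hP, hcost⟩ := exists_implementsMC hfin hd
    (ncard_indexSet_pos hα (by positivity) (div_sqrt_two_lt_one hε1)) (mcSamples_pos hα hε0 hε1)
  have hpow : (1 / ε) ^ (2 * p + 2) = (1 / ε) ^ p * (1 / ε) ^ (p + 2) := by
    rw [← Real.rpow_add (by positivity)]
    congr 1
    ring
  refine ⟨hn.trans (mul_le_mul_of_nonneg_right (le_max_left _ _) (by positivity)), P, hP,
    fun c hc => (hcost c hc).trans ?_⟩
  have h1 : (mcSamples α γ ε d : ℝ) * c
      ≤ max K (18 * (K * K)) * (1 / ε) ^ (p + 2) * c := by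
    gcongr
    exact hn.trans (mul_le_mul_of_nonneg_right (le_max_left _ _) (by positivity))
  have h2 : 18 * (((indexSet α γ (ε / Real.sqrt 2) d).ncard : ℝ) * mcSamples α γ ε d * d)
      ≤ max K (18 * (K * K)) * (1 / ε) ^ (2 * p + 2) * d := by
    calc _ ≤ 18 * ((K * (1 / ε) ^ p) * (K * (1 / ε) ^ (p + 2)) * d) := by gcongr
      _ = 18 * (K * K) * (1 / ε) ^ (2 * p + 2) * d := by rw [hpow]; ring
      _ ≤ _ := by
        gcongr
        exact le_max_right _ _
  linarith

end Implementation

end WeightedKorobov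

end

theorem theorem2 (α : ℝ) (hα : 0 ≤ α) (γ : Weights) :
    -- the class of all continuous linear functionals
    ((StronglyTractable (LambdaAll α γ) ↔ Tractable (LambdaAll α γ)) ∧
      (StronglyTractable (LambdaAll α γ) ↔ sumExponent γ < ⊤ ∧ 0 < α) ∧
      (sumExponent γ < ⊤ ∧ 0 < α →
        strongExponent (LambdaAll α γ) = 2 * max (sumExponent γ).toReal α⁻¹)) ∧
    -- the class of function values
    (1 < α →
      (StronglyTractable (LambdaStd α γ) ↔ Tractable (LambdaStd α γ)) ∧
      (StronglyTractable (LambdaStd α γ) ↔ sumExponent γ < ⊤) ∧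
      (sumExponent γ < ⊤ →
        strongExponent (LambdaStd α γ) ∈
          Set.Icc (strongExponent (LambdaAll α γ)) (strongExponent (LambdaAll α γ) + 2))) ∧
    -- the Monte Carlo algorithm: error, number of samples and total cost
    (1 < α →
      (∀ d : ℕ, 1 ≤ d → ∀ ε : ℝ, 0 < ε → ε < 1 →
        (indexSet α γ (ε / Real.sqrt 2) d).Finite ∧
        IsRandomizedAlgorithm (LambdaStd α γ d) (mcSamples α γ ε d) volume
          (mcAlgorithm (α := α) (γ := γ) (d := d) ε) ∧
        ranError volume (mcAlgorithm (α := α) (γ := γ) (d := d) ε) ≤ ENNReal.ofReal ε) ∧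
      (sumExponent γ < ⊤ → ∀ δ : ℝ, 0 < δ → ∃ K : ℝ, 0 < K ∧ ∀ d : ℕ, 1 ≤ d → ∀ ε : ℝ, 0 < ε → ε < 1 →
        (mcSamples α γ ε d : ℝ) ≤ K * (1 / ε) ^ (strongExponent (LambdaAll α γ) + δ + 2) ∧
        ∃ P : List (Instr ((Fin (mcSamples α γ ε d) × Fin d) ⊕ Fin d) d),
          ImplementsMC α γ ε d P ∧
          ∀ c : ℝ, 0 ≤ c →
            programCost c P ≤
              K * ((1 / ε) ^ (strongExponent (LambdaAll α γ) + δ + 2) * c +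
                (1 / ε) ^ (2 * (strongExponent (LambdaAll α γ) + δ) + 2) * (d : ℝ)))) := by
  have hall : ∀ d, LambdaAll α γ d ⊆ LambdaAll α γ d := fun _ => subset_rfl
  have hiff : Tractable (LambdaAll α γ) → sumExponent γ < ⊤ ∧ 0 < α := fun h => by
    have hα0 : 0 < α := by
      obtain ⟨C, p, q, hC, -, -, hb⟩ := h
      exact hb.pos_of_nonneg hα hall hC
    exact ⟨h.sumExponent_lt_top hα0 hall, hα0⟩
  refine ⟨⟨⟨StronglyTractable.tractable, fun h => ?_⟩,
    ⟨fun h => hiff h.tractable, fun h => stronglyTractable_all h.2 h.1⟩,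
    fun h => strongExponent_all h.2 h.1⟩, fun hα1 => ?_, fun hα1 => ⟨?_, ?_⟩⟩
  · exact stronglyTractable_all (hiff h).2 (hiff h).1
  · have hs : Tractable (LambdaStd α γ) → sumExponent γ < ⊤ := fun h =>
      h.sumExponent_lt_top (one_pos.trans hα1) (lambdaStd_subset_lambdaAll hα1 γ)
    exact ⟨⟨StronglyTractable.tractable, fun h => stronglyTractable_std hα1 (hs h)⟩,
      ⟨fun h => hs h.tractable, stronglyTractable_std hα1⟩, strongExponent_std_mem hα1⟩
  · exact fun d _ ε hε0 hε1 => ⟨finite_indexSet (one_pos.trans hα1) (by positivity),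
      isRandomizedAlgorithm_mc hα1 hε0, ranError_mc_le hα1 hε0 hε1⟩
  · intro h δ hδ
    have hα0 : 0 < α := one_pos.trans hα1
    refine exists_implementsMC_cost_le hα0 h ?_
    rw [strongExponent_all hα0 h]
    exact lt_add_of_pos_right _ hδ
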